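/- Let $d\ge 2$, and let $|\cdot|$ denote the Euclidean norm on $\mathbb R^d$. For a set $E\subseteq\mathbb R^d$ let $\Delta(E)=\{|x-y| : x,y\in E\}$. For a Borel probability measure $\mu$ on $\mathbb R^d$ put $$\widehat\mu(\xi)=\int e^{-i x\cdot\xi}\,d\mu(x),\qquad \mathbb F_\mu(T)=\int_{|\xi|\le T}|\widehat\mu(\xi)|^2\,d\xi .$$ For every $c\in\bigl(0,\tfrac{d-1}{4}\bigr)$, $T_0\ge 1$ and $M\ge 4$ there is a constant $\delta_M>0$, depending only on $d,c,T_0,M$, with the following property. Let $\mu$ be a Borel probability measure supported on a set $E\subseteq[0,1]^d$ (that is, $\mu(\mathbb R^d\setminus E)=0$) such that $$\mathbb F_\mu(T_1T_2)\le T_1^{c}\,\mathbb F_\mu(T_2)\qquad\text{for all } T_1,T_2\ge T_0 .$$ Suppose that $\delta\in(0,\delta_M)$, $J\ge 1$ and $R_1,\dots,R_J\in(T_0,\infty)$ satisfy $$R_{j+1}\ge\delta^{-2}R_j\quad(1\le j<J)\qquad\text{and}\qquad \sum_{j=1}^{J}\mathbb F_\mu(R_j)>\Bigl(1-\frac2M\Bigr)\mathbb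 F_\mu\bigl(\delta^{-2}R_J\bigr).$$ Then $\delta R_j^{-1}\in\Delta(E)$ for at least one $j\in\{1,\dots,J\}$. -/

import Mathlib

open MeasureTheory

noncomputable section

/-- The distance set of `E`: all Euclidean distances `|x - y|` with `x, y ∈ E`. -/
def distanceSet {d : ℕ} (E : Set (EuclideanSpace ℝ (Fin d))) : Set ℝ :=
  {t : ℝ | ∃ x ∈ E, ∃ y ∈ E, ‖x - y‖ = t}

/-- The closed unit cube `[0,1]^d`. -/
def unitCube (d : ℕ) : Set (EuclideanSpace ℝ (Fin d)) :=
  {x | ∀ i, 0 ≤ x i ∧ x i ≤ 1}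

/-- The Fourier transform of a measure, `ξ ↦ ∫ exp (-i x·ξ) dμ(x)`. -/
def measureFourier {d : ℕ} (μ : Measure (EuclideanSpace ℝ (Fin d)))
    (ξ : EuclideanSpace ℝ (Fin d)) : ℂ :=
  ∫ x, Complex.exp (-(Complex.I * ((inner ℝ x ξ : ℝ) : ℂ))) ∂μ

/-- The partial `L²`-Fourier integral `∫_{|ξ| ≤ T} |μ̂(ξ)|² dξ`. -/
def partialFourierIntegral {d : ℕ} (μ : Measure (EuclideanSpace ℝ (Fin d))) (T : ℝ) : ℝ :=
  ∫ ξ in {ξ : EuclideanSpace ℝ (Fin d) | ‖ξ‖ ≤ T}, ‖measureFourier μ ξ‖ ^ 2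

end

open Filter Topology
open scoped RealInnerProductSpace

/-! Let `σ` be the uniform probability measure on the unit sphere. If `t` is not a distance in `E`,
then for `x, y` drawn from `μ` and `θ` from `σ` the vector `x - y + tθ` avoids the origin. Its law
has characteristic function `|μ̂(ξ)|² σ̂(tξ)`, so formally the "density at the origin", the integral
of `|μ̂(ξ)|² σ̂(tξ)` over all `ξ`, is zero (`integral_eq_zero_of_notMem_distanceSet`).

Take `t = δ / R` and split this integral at `|ξ| = R` and `|ξ| = δ⁻² R`. On the ball, `σ̂(tξ) ≥ 1 -
δ² / 2`. On the annulus, `σ̂ ≥ -κ` with `κ < 1/2` (`exists_lower_bound`). On the tail, the decay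
`|σ̂(ξ)| ≲ |ξ|^(-(d-1)/2)` and the growth hypothesis leave an error `O(δ^((d-1)/2 - 2c))` times
`𝔽_μ(R)`; its exponent is positive exactly because `c < (d-1)/4`. Since the total vanishes, the
annulus must carry at least `(1 - o(1)) / κ ≥ 2` times the mass of the ball
(`mass_annulus_of_notMem_distanceSet`).

If every `δ / R_j` failed to be a distance, these annuli would not overlap, so `2 ∑ 𝔽_μ(R_j) ≤
𝔽_μ(δ⁻² R_J)`. This contradicts the assumed lower bound on the sum, as `1 - 2/M ≥ 1/2`.

The decay comes from the Bessel equation for `σ̂`. The bound `κ < 1/2` comes from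
positive-definiteness on an equilateral triangle, with equality excluded by decay. The vanishing is
proved first for compact sets by Gaussian regularisation, then transferred to `E` through an energy
with a positive kernel. -/

/-! ### The uniform measure on the sphere. -/

/-- The real part of the characteristic function of `σ`. -/
noncomputable def cosTransform {d : ℕ} (σ : Measure (EuclideanSpace ℝ (Fin d)))
    (ξ : EuclideanSpace ℝ (Fin d)) : ℝ :=
  ∫ θ, Real.cos ⟪θ, ξ⟫ ∂σ

/-- `σ` is a probability measure on the unit sphere whose cosine transform is radial. -/
structure IsRadialSphereMeasure {d : ℕ} (σ : Measure (EuclideanSpace ℝ (Fin d))) : Prop where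
  isProb : IsProbabilityMeasure σ
  norm_eq_one : ∀ᵐ θ ∂σ, ‖θ‖ = 1
  radial : ∀ ξ η, ‖ξ‖ = ‖η‖ → cosTransform σ ξ = cosTransform σ η

/-- Normalise a uniform point of the unit ball. Radiality follows because two vectors of equal norm
are exchanged by the reflection in the hyperplane orthogonal to their difference, and that
reflection preserves the ball. -/
theorem exists_isRadialSphereMeasure {d : ℕ} (hd : 2 ≤ d) :
    ∃ σ : Measure (EuclideanSpace ℝ (Fin d)), IsRadialSphereMeasure σ := by
  have : Nonempty (Fin d) := ⟨⟨0, by omega⟩⟩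
  have : Nontrivial (EuclideanSpace ℝ (Fin d)) := inferInstance
  set B : Set (EuclideanSpace ℝ (Fin d)) := Metric.ball 0 1 with hB
  have hpos : (volume B) ≠ 0 := (Metric.measure_ball_pos volume _ one_pos).ne'
  have htop : (volume B) ≠ ⊤ := measure_ball_lt_top.ne
  set β : Measure (EuclideanSpace ℝ (Fin d)) := (volume B)⁻¹ • volume.restrict B with hβ
  have hβp : IsProbabilityMeasure β := by
    constructor
    simp [hβ, ENNReal.inv_mul_cancel hpos htop]
  have hmeas : Measurable fun x : EuclideanSpace ℝ (Fin d) => ‖x‖⁻¹ • x := by fun_prop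
  have hcos : ∀ ξ, cosTransform (β.map fun x => ‖x‖⁻¹ • x) ξ =
      ∫ x, Real.cos ⟪‖x‖⁻¹ • x, ξ⟫ ∂β := by
    intro ξ
    rw [cosTransform, integral_map hmeas.aemeasurable]
    exact Continuous.aestronglyMeasurable (by fun_prop)
  refine ⟨β.map fun x => ‖x‖⁻¹ • x, ?_, ?_, ?_⟩
  · exact Measure.isProbabilityMeasure_map hmeas.aemeasurable
  · rw [ae_map_iff hmeas.aemeasurable (measurableSet_eq_fun (by fun_prop) (by fun_prop))]
    have h0 : ∀ᵐ x ∂β, x ≠ 0 := by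
      have : ∀ᵐ x ∂(volume : Measure (EuclideanSpace ℝ (Fin d))), x ≠ 0 := by
        simp [ae_iff]
      exact Measure.ae_smul_measure (ae_restrict_of_ae this) _
    filter_upwards [h0] with x hx
    rw [norm_smul, norm_inv, norm_norm, inv_mul_cancel₀ (norm_ne_zero_iff.2 hx)]
  · intro ξ η h
    rw [hcos, hcos]
    set L := Submodule.reflection (Submodule.span ℝ {ξ - η})ᗮ with hL
    have hLξ : L ξ = η := Submodule.reflection_sub h
    have hmp : MeasurePreserving L β β := by
      have h1 := L.measurePreserving
      have h2 := h1.restrict_preimage (s := B) Metric.isOpen_ball.measurableSet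
      have h3 : L ⁻¹' B = B := by
        ext x; simp [hB]
      rw [h3] at h2
      exact h2.smul_measure _
    have := hmp.integral_comp L.toHomeomorph.measurableEmbedding
      (fun x => Real.cos ⟪‖x‖⁻¹ • x, η⟫)
    rw [← this]
    refine integral_congr_ae (Eventually.of_forall fun x => ?_)
    simp only [LinearIsometryEquiv.norm_map]
    rw [← hLξ, ← L.map_smul, L.inner_map_map]

/-- Differentiation under the integral sign over a finite measure, with a constant bound. -/
theorem hasDerivAt_integral_of_bounded {Ω : Type*} [TopologicalSpace Ω] [MeasurableSpace Ω]
    [OpensMeasurableSpace Ω] [SecondCountableTopology Ω]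
    (μ : Measure Ω) [IsFiniteMeasure μ] {F F' : ℝ → Ω → ℝ} (C : ℝ)
    (hF : ∀ x, Continuous (F x)) (hF' : ∀ x, Continuous (F' x))
    (hFb : ∀ x, ∀ᵐ θ ∂μ, |F x θ| ≤ C) (hF'b : ∀ᵐ θ ∂μ, ∀ x, |F' x θ| ≤ C)
    (hder : ∀ θ x, HasDerivAt (fun y => F y θ) (F' x θ) x) (x : ℝ) :
    HasDerivAt (fun y => ∫ θ, F y θ ∂μ) (∫ θ, F' x θ ∂μ) x := by
  refine (hasDerivAt_integral_of_dominated_loc_of_deriv_le (bound := fun _ => C) univ_mem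
    (Eventually.of_forall fun y => (hF y).aestronglyMeasurable)
    (Integrable.of_bound (hF x).aestronglyMeasurable C (hFb x)) (hF' x).aestronglyMeasurable
    ?_ (integrable_const C) (Eventually.of_forall fun θ y _ => hder θ y)).2
  filter_upwards [hF'b] with θ h y _ using h y

/-! ### Rotation invariance and the Bessel equation. -/

section Radial

variable {d : ℕ} {σ : Measure (EuclideanSpace ℝ (Fin d))}

theorem abs_cosTransform_le_one [IsProbabilityMeasure σ] (ξ : EuclideanSpace ℝ (Fin d)) :
    |cosTransform σ ξ| ≤ 1 := by
  have := norm_integral_le_of_norm_le_const (μ := σ) (f := fun θ => Real.cos ⟪θ, ξ⟫) (C := 1)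
    (Eventually.of_forall fun θ => Real.abs_cos_le_one _)
  simpa [cosTransform] using this

theorem continuous_cosTransform [IsProbabilityMeasure σ] : Continuous (cosTransform σ) := by
  refine continuous_of_dominated (bound := fun _ => 1) ?_ ?_ (integrable_const _) ?_
  · intro ξ
    exact Continuous.aestronglyMeasurable (by fun_prop)
  · intro ξ
    exact Eventually.of_forall fun θ => Real.abs_cos_le_one _
  · exact Eventually.of_forall fun θ => by fun_prop

theorem abs_coord_le {θ : EuclideanSpace ℝ (Fin d)} (h : ‖θ‖ = 1) (i : Fin d) : |θ i| ≤ 1 := by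
  have := PiLp.norm_apply_le θ i
  rwa [h] at this

namespace IsRadialSphereMeasure

theorem cosTransform_eq (hσ : IsRadialSphereMeasure σ) (i : Fin d)
    (ξ : EuclideanSpace ℝ (Fin d)) :
    cosTransform σ ξ = ∫ θ, Real.cos (‖ξ‖ * θ i) ∂σ := by
  rw [hσ.radial ξ (EuclideanSpace.single i ‖ξ‖) (by simp), cosTransform]
  simp [EuclideanSpace.inner_single_right]

theorem integral_cos_rotate (hσ : IsRadialSphereMeasure σ) {i j : Fin d} (hij : i ≠ j)
    (s α : ℝ) :
    ∫ θ, Real.cos (s * (Real.cos α * θ i + Real.sin α * θ j)) ∂σ =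
      ∫ θ, Real.cos (s * θ i) ∂σ := by
  have h := hσ.radial (EuclideanSpace.single i (s * Real.cos α) +
    EuclideanSpace.single j (s * Real.sin α)) (EuclideanSpace.single i s) ?_
  · simp only [cosTransform, inner_add_right, EuclideanSpace.inner_single_right] at h
    simp only [starRingEnd_apply, star_trivial] at h
    convert h using 3 with θ
    ring_nf
  · have horth : ⟪EuclideanSpace.single i (s * Real.cos α),
        EuclideanSpace.single j (s * Real.sin α)⟫ = 0 := by
      simp [EuclideanSpace.inner_single_left, hij]
    have h2 := norm_add_sq_eq_norm_sq_add_norm_sq_real horth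
    have h3 : ‖EuclideanSpace.single i (s * Real.cos α) +
        EuclideanSpace.single j (s * Real.sin α)‖ ^ 2 = ‖EuclideanSpace.single i s‖ ^ 2 := by
      rw [sq, h2]
      simp only [PiLp.norm_single, Real.norm_eq_abs, abs_mul_abs_self, sq_abs]
      linear_combination s ^ 2 * Real.sin_sq_add_cos_sq α
    exact (sq_eq_sq₀ (norm_nonneg _) (norm_nonneg _)).1 h3

theorem hasDerivAt_integral_cos (hσ : IsRadialSphereMeasure σ) (i : Fin d) (s : ℝ) :
    HasDerivAt (fun s => ∫ θ, Real.cos (s * θ i) ∂σ) (∫ θ, -(Real.sin (s * θ i) * θ i) ∂σ) s := by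
  have := hσ.isProb
  refine hasDerivAt_integral_of_bounded σ (F := fun s θ => Real.cos (s * θ i))
    (F' := fun s θ => -(Real.sin (s * θ i) * θ i)) 1 (fun x => by fun_prop) (fun x => by fun_prop)
    (fun x => Eventually.of_forall fun θ => Real.abs_cos_le_one _) ?_ ?_ s
  · filter_upwards [hσ.norm_eq_one] with θ hθ x
    rw [abs_neg, abs_mul]
    exact mul_le_one₀ (Real.abs_sin_le_one _) (abs_nonneg _) (abs_coord_le hθ i)
  · intro θ x
    have h := (((hasDerivAt_id x).mul_const (θ i)).cos)
    simpa using h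

theorem hasDerivAt_integral_sin (hσ : IsRadialSphereMeasure σ) (i : Fin d) (s : ℝ) :
    HasDerivAt (fun s => ∫ θ, -(Real.sin (s * θ i) * θ i) ∂σ)
      (∫ θ, -(Real.cos (s * θ i) * θ i ^ 2) ∂σ) s := by
  have := hσ.isProb
  refine hasDerivAt_integral_of_bounded σ (F := fun s θ => -(Real.sin (s * θ i) * θ i))
    (F' := fun s θ => -(Real.cos (s * θ i) * θ i ^ 2)) 1 (fun x => by fun_prop)
    (fun x => by fun_prop) ?_ ?_ ?_ s
  · intro x
    filter_upwards [hσ.norm_eq_one] with θ hθ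
    rw [abs_neg, abs_mul]
    exact mul_le_one₀ (Real.abs_sin_le_one _) (abs_nonneg _) (abs_coord_le hθ i)
  · filter_upwards [hσ.norm_eq_one] with θ hθ x
    rw [abs_neg, abs_mul, abs_pow]
    exact mul_le_one₀ (Real.abs_cos_le_one _) (by positivity)
      (pow_le_one₀ (abs_nonneg _) (abs_coord_le hθ i))
  · intro θ x
    have h := ((((hasDerivAt_id x).mul_const (θ i)).sin).mul_const (θ i)).neg
    refine h.congr_deriv ?_
    simp only [id]
    ring

/-- The second variation of `integral_cos_rotate` at `α = 0`. -/
theorem integral_cos_mul_sq (hσ : IsRadialSphereMeasure σ) {i j : Fin d} (hij : i ≠ j) (s : ℝ) :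
    s ^ 2 * ∫ θ, Real.cos (s * θ i) * θ j ^ 2 ∂σ = s * ∫ θ, Real.sin (s * θ i) * θ i ∂σ := by
  have := hσ.isProb
  have hb : ∀ θ : EuclideanSpace ℝ (Fin d), ‖θ‖ = 1 → ∀ u v : ℝ, |u| ≤ 1 → |v| ≤ 1 →
      |u * θ i + v * θ j| ≤ 2 := by
    intro θ hθ u v hu hv
    calc |u * θ i + v * θ j| ≤ |u * θ i| + |v * θ j| := abs_add_le _ _
      _ = |u| * |θ i| + |v| * |θ j| := by rw [abs_mul, abs_mul]
      _ ≤ 1 + 1 := add_le_add (mul_le_one₀ hu (abs_nonneg _) (abs_coord_le hθ i))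
          (mul_le_one₀ hv (abs_nonneg _) (abs_coord_le hθ j))
      _ = 2 := by norm_num
  set p : ℝ → EuclideanSpace ℝ (Fin d) → ℝ :=
    fun α θ => Real.cos α * θ i + Real.sin α * θ j with hp
  set q : ℝ → EuclideanSpace ℝ (Fin d) → ℝ :=
    fun α θ => -Real.sin α * θ i + Real.cos α * θ j with hq
  have hpc : ∀ α, Continuous (p α) := fun α => by simp only [hp]; fun_prop
  have hqc : ∀ α, Continuous (q α) := fun α => by simp only [hq]; fun_prop
  have hpd : ∀ θ α, HasDerivAt (fun α => p α θ) (q α θ) α := fun θ α =>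
    ((Real.hasDerivAt_cos α).mul_const _).add ((Real.hasDerivAt_sin α).mul_const _)
  have hqd : ∀ θ α, HasDerivAt (fun α => q α θ) (-p α θ) α := fun θ α => by
    have := ((Real.hasDerivAt_sin α).neg.mul_const (θ i)).add
      ((Real.hasDerivAt_cos α).mul_const (θ j))
    refine this.congr_deriv ?_
    simp only [hp]
    ring
  have hpb : ∀ θ : EuclideanSpace ℝ (Fin d), ‖θ‖ = 1 → ∀ α, |p α θ| ≤ 2 := fun θ hθ α =>
    hb θ hθ _ _ (Real.abs_cos_le_one _) (Real.abs_sin_le_one _)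
  have hqb : ∀ θ : EuclideanSpace ℝ (Fin d), ‖θ‖ = 1 → ∀ α, |q α θ| ≤ 2 := fun θ hθ α =>
    hb θ hθ _ _ (by rw [abs_neg]; exact Real.abs_sin_le_one _) (Real.abs_cos_le_one _)
  -- One constant dominates the integrand (by `1`) and its first two `α`-derivatives (by `2|s|` and
  -- by `4s² + 2|s|`).
  have hfirst_bd : ∀ θ : EuclideanSpace ℝ (Fin d), ‖θ‖ = 1 → ∀ α,
      |-Real.sin (s * p α θ) * (s * q α θ)| ≤ 1 + 2 * |s| + 4 * s ^ 2 := by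
    intro θ hθ α
    have h1 : |Real.sin (s * p α θ)| * |s * q α θ| ≤ 1 * |s * q α θ| :=
      mul_le_mul_of_nonneg_right (Real.abs_sin_le_one _) (abs_nonneg _)
    have h2 : |s * q α θ| ≤ |s| * 2 := by
      rw [abs_mul]; exact mul_le_mul_of_nonneg_left (hqb θ hθ α) (abs_nonneg _)
    rw [abs_mul, abs_neg]
    nlinarith [sq_nonneg s]
  have hfirst : ∀ α, HasDerivAt (fun α => ∫ θ, Real.cos (s * p α θ) ∂σ)
      (∫ θ, -Real.sin (s * p α θ) * (s * q α θ) ∂σ) α := by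
    intro α
    refine hasDerivAt_integral_of_bounded σ (F := fun α θ => Real.cos (s * p α θ))
      (F' := fun α θ => -Real.sin (s * p α θ) * (s * q α θ)) (1 + 2 * |s| + 4 * s ^ 2)
      (fun x => by fun_prop) (fun x => by fun_prop) ?_ ?_ ?_ α
    · intro x
      refine Eventually.of_forall fun θ => (Real.abs_cos_le_one _).trans ?_
      nlinarith [sq_nonneg s, abs_nonneg s]
    · filter_upwards [hσ.norm_eq_one] with θ hθ x using hfirst_bd θ hθ x
    · exact fun θ x => ((hpd θ x).const_mul s).cos
  -- The integral does not depend on `α`, so its first derivative vanishes identically;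
  -- differentiating this once more at `α = 0` gives the identity.
  have hzero : ∀ α, ∫ θ, -Real.sin (s * p α θ) * (s * q α θ) ∂σ = 0 := by
    intro α
    have h1 := hfirst α
    have h2 : (fun α => ∫ θ, Real.cos (s * p α θ) ∂σ) = fun _ => ∫ θ, Real.cos (s * θ i) ∂σ :=
      funext fun α => hσ.integral_cos_rotate hij s α
    rw [h2] at h1
    exact h1.unique (hasDerivAt_const α _)
  have hsecond : HasDerivAt (fun α => ∫ θ, -Real.sin (s * p α θ) * (s * q α θ) ∂σ)
      (∫ θ, (-(Real.cos (s * p 0 θ) * (s * q 0 θ)) * (s * q 0 θ) +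
        -Real.sin (s * p 0 θ) * (s * -p 0 θ)) ∂σ) 0 := by
    refine hasDerivAt_integral_of_bounded σ
      (F := fun α θ => -Real.sin (s * p α θ) * (s * q α θ))
      (F' := fun α θ => -(Real.cos (s * p α θ) * (s * q α θ)) * (s * q α θ) +
        -Real.sin (s * p α θ) * (s * -p α θ)) (1 + 2 * |s| + 4 * s ^ 2)
      (fun x => by fun_prop) (fun x => by fun_prop) ?_ ?_ ?_ 0
    · intro x
      filter_upwards [hσ.norm_eq_one] with θ hθ using hfirst_bd θ hθ x
    · filter_upwards [hσ.norm_eq_one] with θ hθ x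
      have h1 : |-(Real.cos (s * p x θ) * (s * q x θ)) * (s * q x θ)| ≤ 4 * s ^ 2 := by
        have e1 : |-(Real.cos (s * p x θ) * (s * q x θ)) * (s * q x θ)| =
            |Real.cos (s * p x θ)| * (s ^ 2 * |q x θ| ^ 2) := by
          rw [abs_mul, abs_neg, abs_mul, abs_mul, ← sq_abs s]; ring
        have e2 : |q x θ| ^ 2 ≤ 2 ^ 2 := pow_le_pow_left₀ (abs_nonneg _) (hqb θ hθ x) 2
        rw [e1]
        calc |Real.cos (s * p x θ)| * (s ^ 2 * |q x θ| ^ 2) ≤ 1 * (s ^ 2 * |q x θ| ^ 2) :=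
              mul_le_mul_of_nonneg_right (Real.abs_cos_le_one _) (by positivity)
          _ ≤ 4 * s ^ 2 := by nlinarith [sq_nonneg s]
      have h2 : |-Real.sin (s * p x θ) * (s * -p x θ)| ≤ 2 * |s| := by
        have e1 : |-Real.sin (s * p x θ) * (s * -p x θ)| =
            |Real.sin (s * p x θ)| * (|s| * |p x θ|) := by
          rw [abs_mul, abs_neg, abs_mul, abs_neg]
        rw [e1]
        calc |Real.sin (s * p x θ)| * (|s| * |p x θ|) ≤ 1 * (|s| * |p x θ|) :=
              mul_le_mul_of_nonneg_right (Real.abs_sin_le_one _) (by positivity)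
          _ ≤ 2 * |s| := by nlinarith [abs_nonneg s, hpb θ hθ x]
      refine (abs_add_le _ _).trans ?_
      linarith
    · intro θ x
      have h := ((hpd θ x).const_mul s).sin.neg.mul ((hqd θ x).const_mul s)
      exact h
  have hfin : ∫ θ, (-(Real.cos (s * p 0 θ) * (s * q 0 θ)) * (s * q 0 θ) +
        -Real.sin (s * p 0 θ) * (s * -p 0 θ)) ∂σ = 0 := by
    simp only [hzero] at hsecond
    exact hsecond.unique (hasDerivAt_const 0 _)
  have hI1 : Integrable (fun θ => Real.cos (s * θ i) * θ j ^ 2) σ := by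
    refine Integrable.of_bound (Continuous.aestronglyMeasurable (by fun_prop)) 1 ?_
    filter_upwards [hσ.norm_eq_one] with θ hθ
    rw [Real.norm_eq_abs, abs_mul, abs_pow]
    exact mul_le_one₀ (Real.abs_cos_le_one _) (by positivity)
      (pow_le_one₀ (abs_nonneg _) (abs_coord_le hθ j))
  have hI2 : Integrable (fun θ => Real.sin (s * θ i) * θ i) σ := by
    refine Integrable.of_bound (Continuous.aestronglyMeasurable (by fun_prop)) 1 ?_
    filter_upwards [hσ.norm_eq_one] with θ hθ
    rw [Real.norm_eq_abs, abs_mul]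
    exact mul_le_one₀ (Real.abs_sin_le_one _) (abs_nonneg _) (abs_coord_le hθ i)
  have hkey : s * (∫ θ, Real.sin (s * θ i) * θ i ∂σ) -
      s ^ 2 * (∫ θ, Real.cos (s * θ i) * θ j ^ 2 ∂σ) = 0 := by
    rw [← integral_const_mul, ← integral_const_mul, ← integral_sub (hI2.const_mul _)
      (hI1.const_mul _), ← hfin]
    refine integral_congr_ae (Eventually.of_forall fun θ => ?_)
    simp only [hp, hq, Real.cos_zero, Real.sin_zero]
    ring_nf
  linarith

/-- Insert `∑ θ_j² = 1` under the integral. The term `j = i` is minus the second derivative, and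
each of the other `d - 1` terms equals `s⁻¹ ∫ sin(sθ_i) θ_i` by `integral_cos_mul_sq`. -/
theorem bessel_ode (hσ : IsRadialSphereMeasure σ) (i : Fin d) {s : ℝ} (hs : s ≠ 0) :
    (∫ θ, -(Real.cos (s * θ i) * θ i ^ 2) ∂σ) =
      -(∫ θ, Real.cos (s * θ i) ∂σ)
        - ((d : ℝ) - 1) / s * ∫ θ, -(Real.sin (s * θ i) * θ i) ∂σ := by
  have := hσ.isProb
  have hI : ∀ j, Integrable (fun θ => Real.cos (s * θ i) * θ j ^ 2) σ := by
    intro j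
    refine Integrable.of_bound (Continuous.aestronglyMeasurable (by fun_prop)) 1 ?_
    filter_upwards [hσ.norm_eq_one] with θ hθ
    rw [Real.norm_eq_abs, abs_mul, abs_pow]
    exact mul_le_one₀ (Real.abs_cos_le_one _) (by positivity)
      (pow_le_one₀ (abs_nonneg _) (abs_coord_le hθ j))
  have hj : ∀ j ∈ Finset.univ.erase i, ∫ θ, Real.cos (s * θ i) * θ j ^ 2 ∂σ =
      (1 / s) * ∫ θ, Real.sin (s * θ i) * θ i ∂σ := by
    intro j hj
    have := hσ.integral_cos_mul_sq (Finset.ne_of_mem_erase hj).symm s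
    rw [one_div, eq_inv_mul_iff_mul_eq₀ hs]
    have h2 : s * (s * ∫ θ, Real.cos (s * θ i) * θ j ^ 2 ∂σ) =
        s * ∫ θ, Real.sin (s * θ i) * θ i ∂σ := by rw [← this]; ring
    exact mul_left_cancel₀ hs h2
  have hsum : ∫ θ, Real.cos (s * θ i) ∂σ = ∑ j, ∫ θ, Real.cos (s * θ i) * θ j ^ 2 ∂σ := by
    rw [← integral_finsetSum _ fun j _ => hI j]
    refine integral_congr_ae ?_
    filter_upwards [hσ.norm_eq_one] with θ hθ
    rw [← Finset.mul_sum]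
    have := EuclideanSpace.real_norm_sq_eq θ
    rw [← this, hθ]; simp
  rw [← Finset.add_sum_erase _ _ (Finset.mem_univ i), Finset.sum_congr rfl hj] at hsum
  rw [Finset.sum_const, Finset.card_erase_of_mem (Finset.mem_univ i), Finset.card_univ,
    Fintype.card_fin, nsmul_eq_mul, Nat.cast_sub (Nat.one_le_iff_ne_zero.2 (Fin.pos i).ne')] at hsum
  rw [integral_neg, integral_neg, hsum]
  push_cast
  field_simp
  ring

end IsRadialSphereMeasure

end Radial

/-! ### Decay of the cosine transform. -/

/-- Solutions of a Bessel-type equation with damping term `m / s` decay like `s ^ (-m / 2)`. -/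
theorem bessel_ode_decay (m : ℕ) (g g₁ : ℝ → ℝ) (hg : ∀ s, 0 < s → HasDerivAt g (g₁ s) s)
    (hg₁ : ∀ s, 0 < s → HasDerivAt g₁ (-g s - m / s * g₁ s) s) :
    ∃ C, ∀ s, 1 ≤ s → s ^ m * g s ^ 2 ≤ C := by
  set a : ℝ := m / 2 with ha
  have hm : (m : ℝ) = 2 * a := by rw [ha]; ring
  set N : ℝ := |a ^ 2 - a| with hN
  -- With `h = s^a g`, the damping disappears: `h'' = -h + (a² - a) h / s²`. Here `Q = h² + h'²`, so
  -- `|Q'| ≤ N Q / s²`, and the integrability of `s⁻²` at infinity keeps `Q` bounded.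
  set Q : ℝ → ℝ := fun s => s ^ m * (g s ^ 2 + (g₁ s + a * g s / s) ^ 2) with hQ
  have hQ' : ∀ s, 0 < s →
      HasDerivAt Q (s ^ m * (2 * (g₁ s + a * g s / s) * g s * ((a ^ 2 - a) / s ^ 2))) s := by
    intro s hs
    have h1 := hg s hs
    have h2 := hg₁ s hs
    have h3 := (hasDerivAt_pow m s).mul
      ((h1.pow 2).add ((h2.add ((h1.const_mul a).div (hasDerivAt_id s) hs.ne')).pow 2))
    refine h3.congr_deriv ?_
    have hpow : (m : ℝ) * s ^ (m - 1) = s ^ m * (2 * a / s) := by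
      rcases Nat.eq_zero_or_pos m with h0 | h0
      · have : a = 0 := by rw [ha, h0]; simp
        simp [h0, this]
      · obtain ⟨k, rfl⟩ : ∃ k, m = k + 1 := ⟨m - 1, by omega⟩
        rw [hm, Nat.add_sub_cancel, pow_succ]
        field_simp
    simp only [Pi.add_apply, Pi.pow_apply, id, Pi.div_apply, Nat.add_one_sub_one, pow_one,
      Nat.cast_ofNat]
    rw [hpow, hm]
    field_simp
    ring
  -- The integrating factor `exp(N / s)` has logarithmic derivative `-N / s²`, which absorbs the
  -- growth of `Q`.
  have hE : ∀ s, 0 < s → HasDerivAt (fun s => Q s * Real.exp (N / s))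
      ((s ^ m * (2 * (g₁ s + a * g s / s) * g s * ((a ^ 2 - a) / s ^ 2)) - N / s ^ 2 * Q s) *
        Real.exp (N / s)) s := by
    intro s hs
    have h1 := ((hasDerivAt_const s N).div (hasDerivAt_id s) hs.ne').exp
    refine ((hQ' s hs).mul h1).congr_deriv ?_
    simp only [id, Pi.div_apply]
    ring
  have hneg : ∀ s, 0 < s →
      (s ^ m * (2 * (g₁ s + a * g s / s) * g s * ((a ^ 2 - a) / s ^ 2)) - N / s ^ 2 * Q s) *
        Real.exp (N / s) ≤ 0 := by
    intro s hs
    refine mul_nonpos_of_nonpos_of_nonneg ?_ (Real.exp_pos _).le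
    have key : 2 * (g₁ s + a * g s / s) * g s * (a ^ 2 - a) ≤
        N * (g s ^ 2 + (g₁ s + a * g s / s) ^ 2) := by
      set u := g₁ s + a * g s / s
      have h1 : |2 * u * g s| ≤ g s ^ 2 + u ^ 2 := by
        rw [abs_le]; constructor <;> nlinarith [sq_nonneg (g s + u), sq_nonneg (g s - u)]
      calc 2 * u * g s * (a ^ 2 - a) ≤ |2 * u * g s * (a ^ 2 - a)| := le_abs_self _
        _ = N * |2 * u * g s| := by rw [abs_mul, mul_comm]
        _ ≤ _ := mul_le_mul_of_nonneg_left h1 (abs_nonneg _)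
    have h2 : s ^ m * (2 * (g₁ s + a * g s / s) * g s * ((a ^ 2 - a) / s ^ 2)) - N / s ^ 2 * Q s =
        s ^ m / s ^ 2 * (2 * (g₁ s + a * g s / s) * g s * (a ^ 2 - a) -
          N * (g s ^ 2 + (g₁ s + a * g s / s) ^ 2)) := by
      simp only [hQ]; ring
    rw [h2]
    exact mul_nonpos_of_nonneg_of_nonpos (by positivity) (by linarith)
  have hanti : AntitoneOn (fun s => Q s * Real.exp (N / s)) (Set.Ici 1) := by
    refine antitoneOn_of_hasDerivWithinAt_nonpos (convex_Ici 1)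
      (fun s hs => (hE s (lt_of_lt_of_le one_pos hs)).continuousAt.continuousWithinAt)
      (fun s hs => (hE s ?_).hasDerivWithinAt) (fun s hs => hneg s ?_)
    all_goals
      rw [interior_Ici] at hs
      exact lt_trans one_pos hs
  refine ⟨Q 1 * Real.exp (N / 1), fun s hs => ?_⟩
  have hs0 : 0 < s := lt_of_lt_of_le one_pos hs
  have h1 := hanti (Set.mem_Ici.2 le_rfl) (Set.mem_Ici.2 hs) hs
  have h2 : s ^ m * g s ^ 2 ≤ Q s :=
    mul_le_mul_of_nonneg_left (le_add_of_nonneg_right (sq_nonneg _)) (by positivity)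
  have h3 : Q s ≤ Q s * Real.exp (N / s) :=
    le_mul_of_one_le_right (by positivity) (Real.one_le_exp (by positivity))
  exact h2.trans (h3.trans h1)

namespace IsRadialSphereMeasure

variable {d : ℕ} {σ : Measure (EuclideanSpace ℝ (Fin d))}

theorem exists_abs_cosTransform_le (hσ : IsRadialSphereMeasure σ) (hd : 2 ≤ d) :
    ∃ C : ℝ, 1 ≤ C ∧ ∀ ξ, ξ ≠ 0 → |cosTransform σ ξ| ≤ C * ‖ξ‖ ^ (-(((d : ℝ) - 1) / 2)) := by
  have := hσ.isProb
  set i : Fin d := ⟨0, by omega⟩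
  obtain ⟨m, rfl⟩ : ∃ m, d = m + 1 := ⟨d - 1, by omega⟩
  obtain ⟨C, hC⟩ := bessel_ode_decay m (fun s => ∫ θ, Real.cos (s * θ i) ∂σ)
    (fun s => ∫ θ, -(Real.sin (s * θ i) * θ i) ∂σ) (fun s _ => hσ.hasDerivAt_integral_cos i s)
    (fun s hs => by
      have h := hσ.hasDerivAt_integral_sin i s
      rw [hσ.bessel_ode i hs.ne'] at h
      simpa using h)
  -- The `1` serves `‖ξ‖ ≤ 1`, where the power of `‖ξ‖` is at least `1` and the trivial bound
  -- suffices.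
  refine ⟨max 1 (Real.sqrt C), le_max_left _ _, fun ξ hξ => ?_⟩
  have hpos : 0 < ‖ξ‖ := norm_pos_iff.2 hξ
  have hm : ((m + 1 : ℕ) : ℝ) - 1 = m := by push_cast; ring
  rw [hm]
  rcases le_total 1 ‖ξ‖ with h1 | h1
  · have h2 := hC ‖ξ‖ h1
    simp only at h2
    rw [← hσ.cosTransform_eq i ξ] at h2
    have h3 : |cosTransform σ ξ| ≤ Real.sqrt C * ‖ξ‖ ^ (-((m : ℝ) / 2)) := by
      refine abs_le_of_sq_le_sq ?_ (by positivity)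
      have hC0 : 0 ≤ C := le_trans (by positivity) h2
      have h4 : (‖ξ‖ ^ (-((m : ℝ) / 2))) ^ 2 = (‖ξ‖ ^ m)⁻¹ := by
        rw [← Real.rpow_natCast, ← Real.rpow_mul hpos.le, ← Real.rpow_natCast, ← Real.rpow_neg hpos.le]
        congr 1; push_cast; ring
      rw [mul_pow, Real.sq_sqrt hC0, h4, ← div_eq_mul_inv, le_div_iff₀ (by positivity)]
      linarith
    exact h3.trans (mul_le_mul_of_nonneg_right (le_max_right _ _) (by positivity))
  · refine (abs_cosTransform_le_one ξ).trans ?_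
    have h2 : 1 ≤ ‖ξ‖ ^ (-((m : ℝ) / 2)) :=
      Real.one_le_rpow_of_pos_of_le_one_of_nonpos hpos h1 (by
        have : (0 : ℝ) ≤ m := by positivity
        linarith)
    exact one_le_mul_of_one_le_of_one_le (le_max_left _ _) h2

/-! ### Lower bounds for the cosine transform. -/

theorem one_sub_le_cosTransform (hσ : IsRadialSphereMeasure σ) (ξ : EuclideanSpace ℝ (Fin d)) :
    1 - ‖ξ‖ ^ 2 / 2 ≤ cosTransform σ ξ := by
  have := hσ.isProb
  have h1 : ∫ _θ, (1 - ‖ξ‖ ^ 2 / 2) ∂σ ≤ cosTransform σ ξ := by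
    refine integral_mono_ae (integrable_const _)
      (Integrable.of_bound (Continuous.aestronglyMeasurable (by fun_prop)) 1
        (Eventually.of_forall fun θ => Real.abs_cos_le_one _)) ?_
    filter_upwards [hσ.norm_eq_one] with θ hθ
    have h2 := Real.one_sub_sq_div_two_le_cos (x := ⟪θ, ξ⟫)
    have h3 : |⟪θ, ξ⟫| ≤ ‖ξ‖ := by simpa [hθ] using abs_real_inner_le_norm θ ξ
    have h4 := sq_le_sq' (neg_le_of_abs_le h3) (le_of_abs_le h3)
    linarith
  simpa using h1

theorem integrable_cos (hσ : IsRadialSphereMeasure σ) (ξ : EuclideanSpace ℝ (Fin d)) :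
    Integrable (fun θ => Real.cos ⟪θ, ξ⟫) σ := by
  have := hσ.isProb
  exact Integrable.of_bound (Continuous.aestronglyMeasurable (by fun_prop)) 1
    (Eventually.of_forall fun θ => Real.abs_cos_le_one _)

/-- Positive-definiteness of the cosine transform, tested on an equilateral triangle. -/
theorem integral_triangle (hσ : IsRadialSphereMeasure σ) {ξ η : EuclideanSpace ℝ (Fin d)}
    (h₁ : ‖η‖ = ‖ξ‖) (h₂ : ‖ξ - η‖ = ‖ξ‖) :
    ∫ θ, ((1 + Real.cos ⟪θ, ξ⟫ + Real.cos ⟪θ, η⟫) ^ 2 +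
      (Real.sin ⟪θ, ξ⟫ + Real.sin ⟪θ, η⟫) ^ 2) ∂σ = 3 + 6 * cosTransform σ ξ := by
  have := hσ.isProb
  have e : ∀ θ : EuclideanSpace ℝ (Fin d), (1 + Real.cos ⟪θ, ξ⟫ + Real.cos ⟪θ, η⟫) ^ 2 +
      (Real.sin ⟪θ, ξ⟫ + Real.sin ⟪θ, η⟫) ^ 2 =
      3 + 2 * Real.cos ⟪θ, ξ⟫ + 2 * Real.cos ⟪θ, η⟫ + 2 * Real.cos ⟪θ, ξ - η⟫ := by
    intro θ
    rw [inner_sub_right, Real.cos_sub]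
    linear_combination Real.sin_sq_add_cos_sq ⟪θ, ξ⟫ + Real.sin_sq_add_cos_sq ⟪θ, η⟫
  simp_rw [e]
  have i1 := (hσ.integrable_cos ξ).const_mul 2
  have i2 := (hσ.integrable_cos η).const_mul 2
  have i3 := (hσ.integrable_cos (ξ - η)).const_mul 2
  have i0 : Integrable (fun _ : EuclideanSpace ℝ (Fin d) => (3 : ℝ)) σ := integrable_const _
  have i01 : Integrable (fun θ : EuclideanSpace ℝ (Fin d) => 3 + 2 * Real.cos ⟪θ, ξ⟫) σ := i0.add i1
  have i012 : Integrable (fun θ : EuclideanSpace ℝ (Fin d) =>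
    3 + 2 * Real.cos ⟪θ, ξ⟫ + 2 * Real.cos ⟪θ, η⟫) σ := i01.add i2
  rw [integral_add i012 i3, integral_add i01 i2, integral_add i0 i1]
  simp only [integral_const_mul]
  have r1 : ∫ θ, Real.cos ⟪θ, η⟫ ∂σ = cosTransform σ ξ := hσ.radial _ _ h₁
  have r2 : ∫ θ, Real.cos ⟪θ, ξ - η⟫ ∂σ = cosTransform σ ξ := hσ.radial _ _ h₂
  have r0 : ∫ θ, Real.cos ⟪θ, ξ⟫ ∂σ = cosTransform σ ξ := rfl
  rw [r0, r1, r2]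
  simp
  ring

theorem exists_equilateral (hd : 2 ≤ d) (s : ℝ) (hs : 0 ≤ s) :
    ∃ ξ η : EuclideanSpace ℝ (Fin d), ‖ξ‖ = s ∧ ‖η‖ = s ∧ ‖ξ - η‖ = s := by
  set i : Fin d := ⟨0, by omega⟩
  set j : Fin d := ⟨1, by omega⟩
  have hij : i ≠ j := by simp [i, j]
  have key : ∀ u v : ℝ, u ^ 2 + v ^ 2 = s ^ 2 →
      ‖(EuclideanSpace.single i u + EuclideanSpace.single j v : EuclideanSpace ℝ (Fin d))‖ = s := by
    intro u v huv
    have horth : ⟪(EuclideanSpace.single i u : EuclideanSpace ℝ (Fin d)),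
        EuclideanSpace.single j v⟫ = 0 := by
      simp [EuclideanSpace.inner_single_left, hij]
    have h2 := norm_add_sq_eq_norm_sq_add_norm_sq_real horth
    refine (sq_eq_sq₀ (norm_nonneg _) hs).1 ?_
    rw [sq, h2]
    simp only [PiLp.norm_single, Real.norm_eq_abs, abs_mul_abs_self]
    linarith
  have h3 : (Real.sqrt 3) ^ 2 = 3 := Real.sq_sqrt (by norm_num)
  refine ⟨EuclideanSpace.single i s, EuclideanSpace.single i (s / 2) +
    EuclideanSpace.single j (s * Real.sqrt 3 / 2), by simp [abs_of_nonneg hs], key _ _ ?_, ?_⟩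
  · linear_combination s ^ 2 / 4 * h3
  · have : (EuclideanSpace.single i s : EuclideanSpace ℝ (Fin d)) -
        (EuclideanSpace.single i (s / 2) + EuclideanSpace.single j (s * Real.sqrt 3 / 2)) =
        EuclideanSpace.single i (s / 2) + EuclideanSpace.single j (-(s * Real.sqrt 3 / 2)) := by
      ext k
      simp only [PiLp.sub_apply, PiLp.add_apply, PiLp.single_apply]
      split_ifs <;> ring
    rw [this]
    exact key _ _ (by linear_combination s ^ 2 / 4 * h3)

/-- The triangle integral is `∫ |1 + e^{i⟨θ,ξ⟩} + e^{i⟨θ,η⟩}|² dσ ≥ 0`. -/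
theorem neg_half_le_cosTransform (hσ : IsRadialSphereMeasure σ) (hd : 2 ≤ d)
    (ζ : EuclideanSpace ℝ (Fin d)) : -(1 / 2) ≤ cosTransform σ ζ := by
  obtain ⟨ξ, η, h1, h2, h3⟩ := exists_equilateral hd ‖ζ‖ (norm_nonneg _)
  have h := hσ.integral_triangle (h2.trans h1.symm) (h3.trans h1.symm)
  have h0 : 0 ≤ 3 + 6 * cosTransform σ ξ := by
    rw [← h]; exact integral_nonneg fun θ => by positivity
  rw [← hσ.radial ξ ζ h1]
  linarith

/-- If the lower bound `-1/2` is attained at `ζ`, it is also attained at `2 ζ`. -/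
theorem cosTransform_two_smul (hσ : IsRadialSphereMeasure σ) (hd : 2 ≤ d)
    {ζ : EuclideanSpace ℝ (Fin d)} (hζ : cosTransform σ ζ = -(1 / 2)) :
    cosTransform σ ((2 : ℝ) • ζ) = -(1 / 2) := by
  have := hσ.isProb
  obtain ⟨ξ, η, h1, h2, h3⟩ := exists_equilateral hd ‖ζ‖ (norm_nonneg _)
  have h := hσ.integral_triangle (h2.trans h1.symm) (h3.trans h1.symm)
  rw [hσ.radial ξ ζ h1, hζ] at h
  norm_num at h
  rw [integral_eq_zero_iff_of_nonneg (fun θ => by positivity)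
    (Integrable.of_bound (Continuous.aestronglyMeasurable (by fun_prop)) 13
      (Eventually.of_forall fun θ => by
        have := Real.sin_sq_add_cos_sq ⟪θ, ξ⟫
        have := Real.sin_sq_add_cos_sq ⟪θ, η⟫
        rw [Real.norm_of_nonneg (by positivity)]
        nlinarith [Real.cos_le_one ⟪θ, ξ⟫, Real.cos_le_one ⟪θ, η⟫,
          sq_nonneg (Real.cos ⟪θ, ξ⟫ - Real.cos ⟪θ, η⟫),
          sq_nonneg (Real.sin ⟪θ, ξ⟫ - Real.sin ⟪θ, η⟫)]))] at h
  rw [← hσ.radial ((2 : ℝ) • ξ) ((2 : ℝ) • ζ) (by simp [norm_smul, h1]), cosTransform]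
  -- Equality forces `1 + z + w = 0` for the unimodular `z = e^{i⟨θ,ξ⟩}` and `w = e^{i⟨θ,η⟩}`. Hence
  -- `z` is a primitive cube root of unity, and so is `z²`.
  have h4 : ∀ᵐ θ ∂σ, Real.cos ⟪θ, (2 : ℝ) • ξ⟫ = -(1 / 2) := by
    filter_upwards [h] with θ hθ
    simp only [Pi.zero_apply] at hθ
    have e1 : 1 + Real.cos ⟪θ, ξ⟫ + Real.cos ⟪θ, η⟫ = 0 := by
      nlinarith [sq_nonneg (1 + Real.cos ⟪θ, ξ⟫ + Real.cos ⟪θ, η⟫),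
        sq_nonneg (Real.sin ⟪θ, ξ⟫ + Real.sin ⟪θ, η⟫)]
    have e2 : Real.sin ⟪θ, ξ⟫ + Real.sin ⟪θ, η⟫ = 0 := by
      nlinarith [sq_nonneg (1 + Real.cos ⟪θ, ξ⟫ + Real.cos ⟪θ, η⟫),
        sq_nonneg (Real.sin ⟪θ, ξ⟫ + Real.sin ⟪θ, η⟫)]
    have s1 := Real.sin_sq_add_cos_sq ⟪θ, ξ⟫
    have s2 := Real.sin_sq_add_cos_sq ⟪θ, η⟫
    have e3 : Real.cos ⟪θ, η⟫ = -1 - Real.cos ⟪θ, ξ⟫ := by linarith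
    have e4 : Real.sin ⟪θ, η⟫ = -Real.sin ⟪θ, ξ⟫ := by linarith
    rw [e3, e4] at s2
    have e5 : Real.cos ⟪θ, ξ⟫ = -(1 / 2) := by nlinarith
    rw [inner_smul_right, Real.cos_two_mul, e5]
    norm_num
  rw [integral_congr_ae h4]
  simp

/-- Equality at `ζ` would propagate to every `2^n ζ`, contradicting decay at infinity. -/
theorem neg_half_lt_cosTransform (hσ : IsRadialSphereMeasure σ) (hd : 2 ≤ d)
    (ζ : EuclideanSpace ℝ (Fin d)) : -(1 / 2) < cosTransform σ ζ := by
  refine lt_of_le_of_ne (hσ.neg_half_le_cosTransform hd ζ) fun h => ?_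
  have hn : ∀ n : ℕ, cosTransform σ ((2 : ℝ) ^ n • ζ) = -(1 / 2) := by
    intro n
    induction n with
    | zero => simpa using h.symm
    | succ n ih => rw [pow_succ', mul_smul]; exact hσ.cosTransform_two_smul hd ih
  have := hσ.isProb
  have hζ : ζ ≠ 0 := by
    rintro rfl
    have h0 : cosTransform σ (0 : EuclideanSpace ℝ (Fin d)) = 1 := by simp [cosTransform]
    rw [h0] at h; norm_num at h
  obtain ⟨C, -, hC⟩ := hσ.exists_abs_cosTransform_le hd
  have ha : 0 < ((d : ℝ) - 1) / 2 := by
    have : (2 : ℝ) ≤ d := by exact_mod_cast hd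
    linarith
  have hlim : Tendsto (fun n : ℕ => C * ((2 : ℝ) ^ n * ‖ζ‖) ^ (-(((d : ℝ) - 1) / 2))) atTop
      (𝓝 (C * 0)) := by
    refine Tendsto.const_mul C ((tendsto_rpow_neg_atTop ha).comp ?_)
    exact (tendsto_pow_atTop_atTop_of_one_lt one_lt_two).atTop_mul_const (norm_pos_iff.2 hζ)
  rw [mul_zero] at hlim
  obtain ⟨n, hn'⟩ := (hlim.eventually (gt_mem_nhds (show (0 : ℝ) < 1 / 2 by norm_num))).exists
  have h5 := hC ((2 : ℝ) ^ n • ζ) (smul_ne_zero (by positivity) hζ)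
  rw [hn n, norm_smul, norm_pow, Real.norm_two] at h5
  norm_num at h5 hn'
  linarith

/-- Decay gives a bound by `1/4` outside a large ball; inside, the continuous function attains its
minimum, which is strictly above `-1/2`. -/
theorem exists_lower_bound (hσ : IsRadialSphereMeasure σ) (hd : 2 ≤ d) :
    ∃ κ : ℝ, 0 < κ ∧ κ < 1 / 2 ∧ ∀ ξ, -κ ≤ cosTransform σ ξ := by
  have := hσ.isProb
  obtain ⟨C, -, hC⟩ := hσ.exists_abs_cosTransform_le hd
  have ha : 0 < ((d : ℝ) - 1) / 2 := by
    have : (2 : ℝ) ≤ d := by exact_mod_cast hd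
    linarith
  have hlim : Tendsto (fun s : ℝ => C * s ^ (-(((d : ℝ) - 1) / 2))) atTop (𝓝 (C * 0)) :=
    (tendsto_rpow_neg_atTop ha).const_mul C
  rw [mul_zero] at hlim
  obtain ⟨N, hN⟩ := eventually_atTop.1
    (hlim.eventually (gt_mem_nhds (show (0 : ℝ) < 1 / 4 by norm_num)))
  obtain ⟨ζ, -, hζ⟩ := (isCompact_closedBall (0 : EuclideanSpace ℝ (Fin d)) (max N 1)).exists_isMinOn
    ⟨0, by simp⟩ (continuous_cosTransform (σ := σ)).continuousOn
  refine ⟨max (1 / 4) (-cosTransform σ ζ), by positivity, ?_, fun ξ => ?_⟩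
  · have := hσ.neg_half_lt_cosTransform hd ζ
    exact max_lt (by norm_num) (by linarith)
  · by_cases hξ : ‖ξ‖ ≤ max N 1
    · have := hζ (mem_closedBall_zero_iff.2 hξ)
      have h2 := le_max_right (1 / 4) (-cosTransform σ ζ)
      simp only [Set.mem_ofPred_eq] at this
      linarith
    · push Not at hξ
      have hξ0 : ξ ≠ 0 := by
        rintro rfl
        simp only [norm_zero] at hξ
        linarith [le_max_right N 1]
      have h1 := (hC ξ hξ0).trans_lt (hN ‖ξ‖ ((le_max_left _ _).trans hξ.le))
      have h2 := le_max_left (1 / 4) (-cosTransform σ ζ)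
      linarith [neg_abs_le (cosTransform σ ξ)]

end IsRadialSphereMeasure

/-! ### Gaussian-regularised Fourier identities. -/

section Gaussian

variable {d : ℕ}

theorem re_charFun (σ : Measure (EuclideanSpace ℝ (Fin d))) [IsFiniteMeasure σ]
    (ξ : EuclideanSpace ℝ (Fin d)) : (charFun σ ξ).re = cosTransform σ ξ := by
  have hint : Integrable (fun θ : EuclideanSpace ℝ (Fin d) =>
      Complex.exp ((⟪θ, ξ⟫ : ℝ) * Complex.I)) σ := by
    refine Integrable.of_bound (Continuous.aestronglyMeasurable (by fun_prop)) 1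
      (Eventually.of_forall fun θ => ?_)
    rw [Complex.norm_exp_ofReal_mul_I]
  have h := integral_re hint
  simp only [RCLike.re_to_complex, Complex.exp_ofReal_mul_I_re] at h
  rw [charFun_apply, ← h, cosTransform]

theorem integrable_exp_neg_mul_norm_sq {b : ℝ} (hb : 0 < b) :
    Integrable fun ξ : EuclideanSpace ℝ (Fin d) => Real.exp (-b * ‖ξ‖ ^ 2) := by
  have h := (GaussianFourier.integrable_cexp_neg_mul_sq_norm_add (b := (b : ℂ)) (by simpa using hb)
    0 (0 : EuclideanSpace ℝ (Fin d))).norm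
  refine h.congr (Eventually.of_forall fun ξ => ?_)
  simp only [zero_mul, add_zero, Complex.norm_exp]
  congr 1
  norm_cast

/-- Fubini and the explicit Fourier transform of a Gaussian. As `b → 0` the right side concentrates
on the mass of `ρ` near the origin. -/
theorem integral_charFun_mul_gaussian (ρ : Measure (EuclideanSpace ℝ (Fin d))) [IsFiniteMeasure ρ]
    {b : ℝ} (hb : 0 < b) :
    ∫ ξ, (charFun ρ ξ).re * Real.exp (-b * ‖ξ‖ ^ 2) =
      (Real.pi / b) ^ ((d : ℝ) / 2) * ∫ z, Real.exp (-‖z‖ ^ 2 / (4 * b)) ∂ρ := by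
  have hG := integrable_exp_neg_mul_norm_sq (d := d) hb
  have hprod : Integrable (Function.uncurry fun (ξ z : EuclideanSpace ℝ (Fin d)) =>
      Complex.exp (-(b : ℂ) * (‖ξ‖ : ℂ) ^ 2 + Complex.I * (⟪z, ξ⟫ : ℝ))) (volume.prod ρ) := by
    refine (hG.comp_fst ρ).mono' (Continuous.aestronglyMeasurable (by fun_prop))
      (Eventually.of_forall fun p => ?_)
    simp only [Function.uncurry, Complex.norm_exp]
    apply le_of_eq
    congr 1
    simp [← Complex.ofReal_pow]
  have hswap := integral_integral_swap hprod
  have hl : ∀ ξ : EuclideanSpace ℝ (Fin d),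
      ∫ z, Complex.exp (-(b : ℂ) * (‖ξ‖ : ℂ) ^ 2 + Complex.I * (⟪z, ξ⟫ : ℝ)) ∂ρ =
        ((Real.exp (-b * ‖ξ‖ ^ 2) : ℝ) : ℂ) * charFun ρ ξ := by
    intro ξ
    rw [charFun_apply, ← integral_const_mul]
    refine integral_congr_ae (Eventually.of_forall fun z => ?_)
    simp only [Complex.exp_add]
    push_cast
    ring_nf
  have hr : ∀ z : EuclideanSpace ℝ (Fin d),
      ∫ ξ, Complex.exp (-(b : ℂ) * (‖ξ‖ : ℂ) ^ 2 + Complex.I * (⟪z, ξ⟫ : ℝ)) =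
        (((Real.pi / b) ^ ((d : ℝ) / 2) * Real.exp (-‖z‖ ^ 2 / (4 * b)) : ℝ) : ℂ) := by
    intro z
    rw [GaussianFourier.integral_cexp_neg_mul_sq_norm_add (by simpa using hb)]
    rw [finrank_euclideanSpace_fin, Complex.I_sq]
    push_cast
    rw [Complex.ofReal_cpow (by positivity)]
    push_cast
    ring_nf
  simp_rw [hl, hr] at hswap
  rw [integral_complex_ofReal, integral_const_mul] at hswap
  have hint : Integrable fun ξ : EuclideanSpace ℝ (Fin d) =>
      ((Real.exp (-b * ‖ξ‖ ^ 2) : ℝ) : ℂ) * charFun ρ ξ := by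
    have := hprod.integral_prod_left
    simpa only [Function.uncurry, hl] using this
  have hre := integral_re hint
  rw [hswap] at hre
  simp only [RCLike.re_to_complex, Complex.re_ofReal_mul, Complex.ofReal_re] at hre
  rw [← hre]
  simp only [mul_comm]

/-- The cosine transform of the law of `x - y + t θ` for independent `x, y ∼ ν`, `θ ∼ σ`. -/
theorem re_charFun_autocorrelation (ν σ : Measure (EuclideanSpace ℝ (Fin d))) [IsFiniteMeasure ν]
    [IsFiniteMeasure σ] (t : ℝ) (ξ : EuclideanSpace ℝ (Fin d)) :
    (charFun (((ν.prod ν).prod σ).map fun p => p.1.1 - p.1.2 + t • p.2) ξ).re =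
      ‖charFun ν ξ‖ ^ 2 * cosTransform σ (t • ξ) := by
  have h1 : charFun (((ν.prod ν).prod σ).map fun p => p.1.1 - p.1.2 + t • p.2) ξ =
      charFun ν ξ * charFun ν (-ξ) * charFun σ (t • ξ) := by
    rw [charFun_apply, integral_map (by fun_prop) (Continuous.aestronglyMeasurable (by fun_prop)),
      charFun_apply, charFun_apply, charFun_apply, ← integral_prod_mul, ← integral_prod_mul]
    refine integral_congr_ae (Eventually.of_forall fun p => ?_)
    simp only [← Complex.exp_add]
    congr 1
    simp only [inner_add_left, inner_sub_left, inner_smul_left, inner_neg_right, inner_smul_right]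
    push_cast
    simp
    ring
  rw [h1, charFun_neg, Complex.mul_conj, Complex.re_ofReal_mul, re_charFun, Complex.normSq_eq_norm_sq]

theorem integral_autocorrelation_gaussian (ν σ : Measure (EuclideanSpace ℝ (Fin d)))
    [IsFiniteMeasure ν] [IsFiniteMeasure σ] (t : ℝ) {b : ℝ} (hb : 0 < b) :
    ∫ ξ, ‖charFun ν ξ‖ ^ 2 * cosTransform σ (t • ξ) * Real.exp (-b * ‖ξ‖ ^ 2) =
      (Real.pi / b) ^ ((d : ℝ) / 2) *
        ∫ p, Real.exp (-‖p.1.1 - p.1.2 + t • p.2‖ ^ 2 / (4 * b)) ∂((ν.prod ν).prod σ) := by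
  have h := integral_charFun_mul_gaussian
    (((ν.prod ν).prod σ).map fun p => p.1.1 - p.1.2 + t • p.2) hb
  rw [integral_map (by fun_prop) (Continuous.aestronglyMeasurable (by fun_prop))] at h
  simpa only [re_charFun_autocorrelation] using h

/-- The autocorrelation identity with no spherical shift: `σ` is the Dirac mass at the origin and `t
= 0`. -/
theorem lintegral_normSq_charFun_gaussian (ν : Measure (EuclideanSpace ℝ (Fin d)))
    [IsFiniteMeasure ν] {b : ℝ} (hb : 0 < b) :
    ∫⁻ ξ, ENNReal.ofReal (‖charFun ν ξ‖ ^ 2) * ENNReal.ofReal (Real.exp (-b * ‖ξ‖ ^ 2)) =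
      ∫⁻ p, ENNReal.ofReal ((Real.pi / b) ^ ((d : ℝ) / 2) *
        Real.exp (-‖p.1 - p.2‖ ^ 2 / (4 * b))) ∂(ν.prod ν) := by
  have h := integral_autocorrelation_gaussian ν (Measure.dirac (0 : EuclideanSpace ℝ (Fin d))) 0 hb
  have hcos : cosTransform (Measure.dirac (0 : EuclideanSpace ℝ (Fin d))) 0 = 1 := by
    simp [cosTransform]
  simp only [zero_smul, hcos, add_zero, mul_one] at h
  rw [integral_fun_fst (f := fun p : EuclideanSpace ℝ (Fin d) × EuclideanSpace ℝ (Fin d) =>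
    Real.exp (-‖p.1 - p.2‖ ^ 2 / (4 * b)))] at h
  simp only [probReal_univ, one_smul] at h
  rw [← integral_const_mul] at h
  simp_rw [← ENNReal.ofReal_mul (sq_nonneg _)]
  rw [← ofReal_integral_eq_lintegral_ofReal, ← ofReal_integral_eq_lintegral_ofReal, h]
  · refine (Integrable.of_bound (Continuous.aestronglyMeasurable (by fun_prop)) 1
      (Eventually.of_forall fun p => ?_)).const_mul _
    rw [Real.norm_of_nonneg (Real.exp_pos _).le, Real.exp_le_one_iff]
    exact div_nonpos_of_nonpos_of_nonneg (by simp) (by positivity)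
  · exact Eventually.of_forall fun p => by positivity
  · refine ((integrable_exp_neg_mul_norm_sq (d := d) hb).const_mul (ν.real Set.univ ^ 2)).mono'
      ?_ (Eventually.of_forall fun ξ => ?_)
    · have := (measurable_charFun (μ := ν)).norm
      exact Measurable.aestronglyMeasurable (by fun_prop)
    · rw [Real.norm_of_nonneg (by positivity)]
      have := norm_charFun_le (μ := ν) ξ
      gcongr
  · exact Eventually.of_forall fun p => by positivity

end Gaussian

/-! ### Vanishing of the spherical average at a missing distance. -/

section Vanishing

variable {d : ℕ}

/-- A positive combination of Gaussians comparable to `‖ξ‖ ^ (-a)` at infinity,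
where `q = 2 ^ (-a)`. -/
noncomputable def gaussMix (q : ℝ) (ξ : EuclideanSpace ℝ (Fin d)) : ENNReal :=
  ∑' n : ℕ, ENNReal.ofReal (q ^ n) * ENNReal.ofReal (Real.exp (-(1 / 4) ^ n * ‖ξ‖ ^ 2))

/-- The (positive) kernel whose Fourier transform is `gaussMix`. -/
noncomputable def gaussMixKernel (q : ℝ)
    (p : EuclideanSpace ℝ (Fin d) × EuclideanSpace ℝ (Fin d)) : ENNReal :=
  ∑' n : ℕ, ENNReal.ofReal (q ^ n) * ENNReal.ofReal ((Real.pi / (1 / 4) ^ n) ^ ((d : ℝ) / 2) *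
    Real.exp (-‖p.1 - p.2‖ ^ 2 / (4 * (1 / 4) ^ n)))

/-- The energy of `ν` with respect to the kernel `gaussMixKernel q`. -/
noncomputable def gaussMixEnergy (q : ℝ) (ν : Measure (EuclideanSpace ℝ (Fin d))) : ENNReal :=
  ∫⁻ ξ, ENNReal.ofReal (‖charFun ν ξ‖ ^ 2) * gaussMix q ξ

theorem measurable_gaussMix (q : ℝ) :
    Measurable (gaussMix q : EuclideanSpace ℝ (Fin d) → ENNReal) := by
  refine Measurable.tsum fun n => ?_
  fun_prop

theorem gaussMixEnergy_eq (q : ℝ) (ν : Measure (EuclideanSpace ℝ (Fin d))) [IsFiniteMeasure ν] :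
    gaussMixEnergy q ν = ∫⁻ p, gaussMixKernel q p ∂(ν.prod ν) := by
  have hm := (measurable_charFun (μ := ν)).norm
  unfold gaussMixEnergy gaussMixKernel gaussMix
  simp_rw [← ENNReal.tsum_mul_left]
  rw [lintegral_tsum fun n => by fun_prop, lintegral_tsum fun n => by fun_prop]
  congr 1
  ext n
  rw [lintegral_const_mul _ (by fun_prop), ← lintegral_normSq_charFun_gaussian ν (by positivity),
    ← lintegral_const_mul _ (by fun_prop)]
  congr 1
  ext ξ
  ring

/-- Restricting a measure has no simple effect on its Fourier transform, but in the kernel form of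
the energy it only shrinks the domain of a nonnegative integrand. Monotonicity and absolute
continuity of the energy under restriction follow. -/
theorem gaussMixEnergy_restrict (q : ℝ) (μ : Measure (EuclideanSpace ℝ (Fin d)))
    [IsFiniteMeasure μ] (A : Set (EuclideanSpace ℝ (Fin d))) :
    gaussMixEnergy q (μ.restrict A) = ∫⁻ p in A ×ˢ A, gaussMixKernel q p ∂(μ.prod μ) := by
  rw [gaussMixEnergy_eq, Measure.prod_restrict]

theorem gaussMixEnergy_restrict_le (q : ℝ) (μ : Measure (EuclideanSpace ℝ (Fin d)))
    [IsFiniteMeasure μ] (A : Set (EuclideanSpace ℝ (Fin d))) :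
    gaussMixEnergy q (μ.restrict A) ≤ gaussMixEnergy q μ := by
  rw [gaussMixEnergy_restrict, gaussMixEnergy_eq]
  exact setLIntegral_le_lintegral _ _

/-- Absolute continuity of the integral, since `(μ × μ)(A × A) = μ(A)² → 0`. -/
theorem tendsto_gaussMixEnergy_restrict (q : ℝ) (μ : Measure (EuclideanSpace ℝ (Fin d)))
    [IsFiniteMeasure μ] (h : gaussMixEnergy q μ ≠ ⊤) {A : ℕ → Set (EuclideanSpace ℝ (Fin d))}
    (hA : Tendsto (fun n => μ (A n)) atTop (𝓝 0)) :
    Tendsto (fun n => gaussMixEnergy q (μ.restrict (A n))) atTop (𝓝 0) := by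
  simp_rw [gaussMixEnergy_restrict]
  rw [gaussMixEnergy_eq] at h
  refine tendsto_setLIntegral_zero h ?_
  simp only [Function.comp_def, Measure.prod_prod]
  simpa using ENNReal.Tendsto.mul hA (by simp) hA (by simp)

/-- If `t` is not a distance in the compact set `K` carrying `ν`, then the spherical average of
radius `t` of the autocorrelation of `ν` vanishes. -/
theorem integral_eq_zero_of_isCompact {σ ν : Measure (EuclideanSpace ℝ (Fin d))}
    (hσ : IsRadialSphereMeasure σ) [IsFiniteMeasure ν] {K : Set (EuclideanSpace ℝ (Fin d))}
    (hK : IsCompact K) (hν : ν Kᶜ = 0) {t : ℝ} (ht : 0 < t) (htK : t ∉ distanceSet K)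
    (hint : Integrable fun ξ => ‖charFun ν ξ‖ ^ 2 * cosTransform σ (t • ξ)) :
    ∫ ξ, ‖charFun ν ξ‖ ^ 2 * cosTransform σ (t • ξ) = 0 := by
  have := hσ.isProb
  -- Compactness keeps all distances of `K` at least `η` away from `t`; by the reverse triangle
  -- inequality `x - y + tθ` then stays outside the ball of radius `η`.
  obtain ⟨η, hη, hηK⟩ : ∃ η > 0, ∀ x ∈ K, ∀ y ∈ K, η ≤ |‖x - y‖ - t| := by
    rcases K.eq_empty_or_nonempty with rfl | hne
    · exact ⟨1, one_pos, by simp⟩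
    · obtain ⟨p, hp, hmin⟩ := (hK.prod hK).exists_isMinOn (hne.prod hne)
        (f := fun p => |‖p.1 - p.2‖ - t|) (Continuous.continuousOn (by fun_prop))
      refine ⟨|‖p.1 - p.2‖ - t|, ?_, fun x hx y hy =>
        isMinOn_iff.1 hmin (x, y) (Set.mk_mem_prod hx hy)⟩
      refine abs_pos.2 fun h0 => htK ⟨p.1, hp.1, p.2, hp.2, by linarith⟩
  have hae : ∀ᵐ p ∂((ν.prod ν).prod σ), η ≤ ‖p.1.1 - p.1.2 + t • p.2‖ := by
    have h1 : ∀ᵐ x ∂ν, x ∈ K := by rwa [ae_iff]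
    have h2 : ∀ᵐ p ∂(ν.prod ν), p.1 ∈ K :=
      (Measure.quasiMeasurePreserving_fst (μ := ν) (ν := ν)).ae h1
    have h3 : ∀ᵐ p ∂(ν.prod ν), p.2 ∈ K :=
      (Measure.quasiMeasurePreserving_snd (μ := ν) (ν := ν)).ae h1
    have h23 := (Measure.quasiMeasurePreserving_fst (μ := ν.prod ν) (ν := σ)).ae (h2.and h3)
    have h4 := (Measure.quasiMeasurePreserving_snd (μ := ν.prod ν) (ν := σ)).ae hσ.norm_eq_one
    filter_upwards [h23, h4] with p ⟨hp1, hp2⟩ hp3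
    refine (hηK _ hp1 _ hp2).trans ?_
    have h5 := abs_norm_sub_norm_le (p.1.1 - p.1.2) (-(t • p.2))
    rwa [norm_neg, norm_smul, hp3, mul_one, Real.norm_of_nonneg ht.le, sub_neg_eq_add] at h5
  -- Regularise with Gaussian parameter `b = x⁻¹` and let `x → ∞`. On the Fourier side `I` tends to
  -- the desired integral; on the spatial side it is `O(x^(d/2) exp(-η² x / 4))`.
  set I : ℝ → ℝ := fun x =>
    ∫ ξ, ‖charFun ν ξ‖ ^ 2 * cosTransform σ (t • ξ) * Real.exp (-x⁻¹ * ‖ξ‖ ^ 2) with hI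
  have hlim1 : Tendsto I atTop (𝓝 (∫ ξ, ‖charFun ν ξ‖ ^ 2 * cosTransform σ (t • ξ))) := by
    refine tendsto_integral_filter_of_dominated_convergence
      (fun ξ => ‖‖charFun ν ξ‖ ^ 2 * cosTransform σ (t • ξ)‖) ?_ ?_ hint.norm ?_
    · exact Eventually.of_forall fun x => hint.aestronglyMeasurable.mul
        (Continuous.aestronglyMeasurable (by fun_prop))
    · filter_upwards [eventually_gt_atTop 0] with x hx
      refine Eventually.of_forall fun ξ => ?_
      rw [norm_mul _ (Real.exp _), Real.norm_of_nonneg (Real.exp_pos _).le]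
      refine mul_le_of_le_one_right (norm_nonneg _) (Real.exp_le_one_iff.2 ?_)
      have : 0 ≤ x⁻¹ * ‖ξ‖ ^ 2 := by positivity
      linarith
    · refine Eventually.of_forall fun ξ => ?_
      have h1 : Tendsto (fun x : ℝ => Real.exp (-x⁻¹ * ‖ξ‖ ^ 2)) atTop (𝓝 (Real.exp (-0 * ‖ξ‖ ^ 2))) :=
        (Real.continuous_exp.tendsto _).comp (tendsto_inv_atTop_zero.neg.mul_const _)
      simpa using h1.const_mul (‖charFun ν ξ‖ ^ 2 * cosTransform σ (t • ξ))
  have hlim2 : Tendsto I atTop (𝓝 0) := by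
    set m := ((ν.prod ν).prod σ).real Set.univ with hm
    have hbound : Tendsto (fun x : ℝ => (Real.pi ^ ((d : ℝ) / 2) * m) *
        (x ^ ((d : ℝ) / 2) * Real.exp (-(η ^ 2 / 4) * x))) atTop (𝓝 0) := by
      have := (tendsto_rpow_mul_exp_neg_mul_atTop_nhds_zero ((d : ℝ) / 2) (η ^ 2 / 4)
        (by positivity)).const_mul (Real.pi ^ ((d : ℝ) / 2) * m)
      simpa using this
    refine squeeze_zero' ?_ ?_ hbound
    · filter_upwards [eventually_gt_atTop 0] with x hx
      rw [hI]
      simp only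
      rw [integral_autocorrelation_gaussian ν σ t (inv_pos.2 hx)]
      exact mul_nonneg (by positivity) (integral_nonneg fun p => (Real.exp_pos _).le)
    · filter_upwards [eventually_gt_atTop 0] with x hx
      rw [hI]
      simp only
      rw [integral_autocorrelation_gaussian ν σ t (inv_pos.2 hx), div_inv_eq_mul,
        Real.mul_rpow Real.pi_pos.le hx.le]
      have h6 : ∫ p, Real.exp (-‖p.1.1 - p.1.2 + t • p.2‖ ^ 2 / (4 * x⁻¹)) ∂((ν.prod ν).prod σ) ≤
          ∫ _p, Real.exp (-(η ^ 2 / 4) * x) ∂((ν.prod ν).prod σ) := by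
        refine integral_mono_of_nonneg (Eventually.of_forall fun p => (Real.exp_pos _).le)
          (integrable_const _) ?_
        filter_upwards [hae] with p hp
        refine Real.exp_le_exp.2 ?_
        have h7 : η ^ 2 ≤ ‖p.1.1 - p.1.2 + t • p.2‖ ^ 2 := pow_le_pow_left₀ hη.le hp 2
        have h8 : -‖p.1.1 - p.1.2 + t • p.2‖ ^ 2 / (4 * x⁻¹) =
            -(‖p.1.1 - p.1.2 + t • p.2‖ ^ 2 / 4) * x := by field_simp
        rw [h8]
        exact mul_le_mul_of_nonneg_right (by linarith) hx.le
      rw [integral_const, smul_eq_mul, ← hm] at h6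
      calc _ ≤ Real.pi ^ ((d : ℝ) / 2) * x ^ ((d : ℝ) / 2) * (m * Real.exp (-(η ^ 2 / 4) * x)) :=
            mul_le_mul_of_nonneg_left h6 (by positivity)
        _ = _ := by ring
  exact tendsto_nhds_unique hlim1 hlim2

theorem integrable_of_gaussMixEnergy {σ ν : Measure (EuclideanSpace ℝ (Fin d))}
    [IsProbabilityMeasure σ] [IsFiniteMeasure ν] {q C t : ℝ} (hν : gaussMixEnergy q ν ≠ ⊤)
    (hC : ∀ ξ, ENNReal.ofReal |cosTransform σ (t • ξ)| ≤ ENNReal.ofReal C * gaussMix q ξ) :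
    Integrable fun ξ => ‖charFun ν ξ‖ ^ 2 * cosTransform σ (t • ξ) := by
  have hm := (measurable_charFun (μ := ν)).norm
  have hm2 := (continuous_cosTransform (σ := σ)).measurable
  refine ⟨Measurable.aestronglyMeasurable (by fun_prop), ?_⟩
  rw [hasFiniteIntegral_iff_norm]
  calc ∫⁻ ξ, ENNReal.ofReal ‖‖charFun ν ξ‖ ^ 2 * cosTransform σ (t • ξ)‖
      ≤ ∫⁻ ξ, ENNReal.ofReal C * (ENNReal.ofReal (‖charFun ν ξ‖ ^ 2) * gaussMix q ξ) := by
        refine lintegral_mono fun ξ => ?_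
        rw [norm_mul, Real.norm_of_nonneg (sq_nonneg ‖charFun ν ξ‖), ENNReal.ofReal_mul (sq_nonneg _),
          Real.norm_eq_abs, mul_left_comm]
        exact mul_le_mul_right (hC ξ) _
    _ = ENNReal.ofReal C * gaussMixEnergy q ν :=
        lintegral_const_mul' _ _ ENNReal.ofReal_ne_top
    _ < ⊤ := ENNReal.mul_lt_top ENNReal.ofReal_lt_top hν.lt_top

/-- The cross term is split by Young's inequality with weight `η`, so that the large part `x` enters
with an arbitrarily small factor. -/
theorem abs_sq_sub_sq_le {x y z : ℂ} (h : x = y + z) {η : ℝ} (hη : 0 < η) :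
    |‖x‖ ^ 2 - ‖y‖ ^ 2| ≤ η * ‖x‖ ^ 2 + (1 + 1 / η) * ‖z‖ ^ 2 := by
  have h1 : |‖x‖ - ‖y‖| ≤ ‖z‖ := by
    have := abs_norm_sub_norm_le x y
    rwa [h, add_sub_cancel_left, ← h] at this
  have h2 : ‖y‖ ≤ ‖x‖ + ‖z‖ := by linarith [neg_abs_le (‖x‖ - ‖y‖)]
  have h3 : |‖x‖ ^ 2 - ‖y‖ ^ 2| = |‖x‖ - ‖y‖| * (‖x‖ + ‖y‖) := by
    rw [sq_sub_sq, abs_mul, abs_of_nonneg (add_nonneg (norm_nonneg x) (norm_nonneg y)), mul_comm]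
  have h4 : 2 * ‖x‖ * ‖z‖ ≤ η * ‖x‖ ^ 2 + 1 / η * ‖z‖ ^ 2 := by
    have h5 : 0 ≤ 1 / η * (η * ‖x‖ - ‖z‖) ^ 2 := by positivity
    have h6 : 1 / η * (η * ‖x‖ - ‖z‖) ^ 2 =
        η * ‖x‖ ^ 2 + 1 / η * ‖z‖ ^ 2 - 2 * ‖x‖ * ‖z‖ := by field_simp; ring
    linarith
  rw [h3]
  calc |‖x‖ - ‖y‖| * (‖x‖ + ‖y‖) ≤ ‖z‖ * (‖x‖ + (‖x‖ + ‖z‖)) := by gcongr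
    _ ≤ _ := by nlinarith

/-- A measure of finite energy carried by a set without the distance `t` has vanishing spherical
average of radius `t`. -/
theorem integral_eq_zero_of_notMem_distanceSet {σ μ : Measure (EuclideanSpace ℝ (Fin d))}
    (hσ : IsRadialSphereMeasure σ) [IsFiniteMeasure μ] {E : Set (EuclideanSpace ℝ (Fin d))}
    (hμ : μ Eᶜ = 0) {t : ℝ} (ht : 0 < t) (htE : t ∉ distanceSet E) {q C : ℝ}
    (henergy : gaussMixEnergy q μ ≠ ⊤)
    (hC : ∀ ξ, ENNReal.ofReal |cosTransform σ (t • ξ)| ≤ ENNReal.ofReal C * gaussMix q ξ) :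
    ∫ ξ, ‖charFun μ ξ‖ ^ 2 * cosTransform σ (t • ξ) = 0 := by
  have := hσ.isProb
  -- `E` need not be measurable, so it is replaced by a measurable subset of full measure, which is
  -- then exhausted by compact sets.
  set S := (toMeasurable μ Eᶜ)ᶜ with hS
  have hSm : MeasurableSet S := (measurableSet_toMeasurable _ _).compl
  have hSE : S ⊆ E := by
    rw [hS, Set.compl_subset_comm]; exact subset_toMeasurable _ _
  have hSμ : μ Sᶜ = 0 := by rw [hS, compl_compl, measure_toMeasurable, hμ]
  have hK : ∀ n : ℕ, ∃ K ⊆ S, IsCompact K ∧ μ (S \ K) < ENNReal.ofReal (1 / ((n : ℝ) + 1)) :=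
    fun n => hSm.exists_isCompact_sdiff_lt (measure_ne_top _ _)
      (by rw [Ne, ENNReal.ofReal_eq_zero, not_le]; positivity)
  choose K hKS hKc hKμ using hK
  have hKm : ∀ n, MeasurableSet (K n) := fun n => (hKc n).isClosed.measurableSet
  have hKlim : Tendsto (fun n => μ (K n)ᶜ) atTop (𝓝 0) := by
    refine tendsto_of_tendsto_of_tendsto_of_le_of_le tendsto_const_nhds
      (h := fun n : ℕ => ENNReal.ofReal (1 / ((n : ℝ) + 1))) ?_ (fun n => zero_le) (fun n => ?_)
    · simpa using ENNReal.tendsto_ofReal (tendsto_one_div_add_atTop_nhds_zero_nat (𝕜 := ℝ))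
    · have hsub : (K n)ᶜ ⊆ (S \ K n) ∪ Sᶜ := by
        intro x hx
        by_cases hxS : x ∈ S
        · exact Or.inl ⟨hxS, hx⟩
        · exact Or.inr hxS
      calc μ (K n)ᶜ ≤ μ (S \ K n) + μ Sᶜ := (measure_mono hsub).trans (measure_union_le _ _)
        _ ≤ _ := by rw [hSμ, add_zero]; exact (hKμ n).le
  have hlim := tendsto_gaussMixEnergy_restrict q μ henergy hKlim
  have hI := integrable_of_gaussMixEnergy (σ := σ) henergy hC
  set I := ∫ ξ, ‖charFun μ ξ‖ ^ 2 * cosTransform σ (t • ξ) with hIdef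
  -- The compact part has zero spherical average, so `I` only sees the difference of the squared
  -- transforms, controlled by `η` times the full energy and the energy of the remainder.
  have hstep : ∀ η : ℝ, 0 < η → ∀ n, ENNReal.ofReal |I| ≤ ENNReal.ofReal C *
      (ENNReal.ofReal η * gaussMixEnergy q μ +
        ENNReal.ofReal (1 + 1 / η) * gaussMixEnergy q (μ.restrict (K n)ᶜ)) := by
    intro η hη n
    set ν := μ.restrict (K n)
    set α := μ.restrict (K n)ᶜ
    have hmμ := (measurable_charFun (μ := μ)).norm
    have hmα := (measurable_charFun (μ := α)).norm
    have hsplit : ∀ ξ, charFun μ ξ = charFun ν ξ + charFun α ξ := by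
      intro ξ
      simp only [charFun_apply]
      refine (integral_add_compl (hKm n) ?_).symm
      exact Integrable.of_bound (Continuous.aestronglyMeasurable (by fun_prop)) 1
        (Eventually.of_forall fun θ => by rw [Complex.norm_exp_ofReal_mul_I])
    have hνE : gaussMixEnergy q ν ≠ ⊤ :=
      ((gaussMixEnergy_restrict_le q μ _).trans_lt henergy.lt_top).ne
    have hIν := integrable_of_gaussMixEnergy (σ := σ) hνE hC
    have hν0 : ∫ ξ, ‖charFun ν ξ‖ ^ 2 * cosTransform σ (t • ξ) = 0 := by
      refine integral_eq_zero_of_isCompact hσ (hKc n) ?_ ht ?_ hIν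
      · rw [Measure.restrict_apply (hKm n).compl]; simp
      · rintro ⟨x, hx, y, hy, hxy⟩
        exact htE ⟨x, hSE (hKS n hx), y, hSE (hKS n hy), hxy⟩
    have hdiff : I = ∫ ξ, (‖charFun μ ξ‖ ^ 2 - ‖charFun ν ξ‖ ^ 2) * cosTransform σ (t • ξ) := by
      simp_rw [sub_mul]
      rw [integral_sub hI hIν, hν0, sub_zero]
    have hle : ENNReal.ofReal |I| ≤ ∫⁻ ξ,
        ENNReal.ofReal ‖(‖charFun μ ξ‖ ^ 2 - ‖charFun ν ξ‖ ^ 2) * cosTransform σ (t • ξ)‖ := by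
      rw [hdiff, ← Real.norm_eq_abs, ofReal_norm]
      simp_rw [ofReal_norm]
      exact enorm_integral_le_lintegral_enorm _
    refine hle.trans ?_
    calc _ ≤ ∫⁻ ξ, ENNReal.ofReal C * (ENNReal.ofReal η * (ENNReal.ofReal (‖charFun μ ξ‖ ^ 2) *
            gaussMix q ξ) + ENNReal.ofReal (1 + 1 / η) * (ENNReal.ofReal (‖charFun α ξ‖ ^ 2) *
            gaussMix q ξ)) := by
          refine lintegral_mono fun ξ => ?_
          rw [norm_mul, ENNReal.ofReal_mul (norm_nonneg _)]
          have h1 := ENNReal.ofReal_le_ofReal (abs_sq_sub_sq_le (hsplit ξ) hη)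
          rw [ENNReal.ofReal_add (by positivity) (by positivity), ENNReal.ofReal_mul hη.le,
            ENNReal.ofReal_mul (by positivity)] at h1
          refine (mul_le_mul' h1 (hC ξ)).trans (le_of_eq ?_)
          ring
      _ = _ := by
          have hmix := measurable_gaussMix (d := d) q
          rw [lintegral_const_mul' _ _ ENNReal.ofReal_ne_top, lintegral_add_left (by fun_prop),
            lintegral_const_mul' _ _ ENNReal.ofReal_ne_top,
            lintegral_const_mul' _ _ ENNReal.ofReal_ne_top]
          rfl
  -- The order of limits matters: `n → ∞` at fixed `η`, because of the factor `1 + 1/η`, and only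
  -- then `η → 0`.
  have hη : ∀ η : ℝ, 0 < η → ENNReal.ofReal |I| ≤ ENNReal.ofReal C *
      (ENNReal.ofReal η * gaussMixEnergy q μ) := by
    intro η hη
    have h1 : Tendsto (fun n => ENNReal.ofReal C * (ENNReal.ofReal η * gaussMixEnergy q μ +
        ENNReal.ofReal (1 + 1 / η) * gaussMixEnergy q (μ.restrict (K n)ᶜ))) atTop
        (𝓝 (ENNReal.ofReal C * (ENNReal.ofReal η * gaussMixEnergy q μ +
          ENNReal.ofReal (1 + 1 / η) * 0))) :=
      ENNReal.Tendsto.const_mul (tendsto_const_nhds.add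
        (ENNReal.Tendsto.const_mul hlim (Or.inr ENNReal.ofReal_ne_top)))
        (Or.inr ENNReal.ofReal_ne_top)
    rw [mul_zero, add_zero] at h1
    exact ge_of_tendsto' h1 (hstep η hη)
  have hfin : ENNReal.ofReal |I| ≤ ENNReal.ofReal C * (ENNReal.ofReal 0 * gaussMixEnergy q μ) := by
    have h1 : Tendsto (fun η : ℝ => ENNReal.ofReal C * (ENNReal.ofReal η * gaussMixEnergy q μ))
        (𝓝[>] 0) (𝓝 (ENNReal.ofReal C * (ENNReal.ofReal 0 * gaussMixEnergy q μ))) :=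
      ENNReal.Tendsto.const_mul (ENNReal.Tendsto.mul_const
        ((ENNReal.continuous_ofReal.tendsto 0).mono_left nhdsWithin_le_nhds) (Or.inr henergy))
        (Or.inr ENNReal.ofReal_ne_top)
    exact ge_of_tendsto h1 (eventually_mem_nhdsWithin.mono fun η h => hη η h)
  simpa using hfin

end Vanishing

/-! ### Partial Fourier integrals and their weighted tails. -/

section PartialFourier

variable {d : ℕ} (μ : Measure (EuclideanSpace ℝ (Fin d)))

theorem norm_measureFourier (ξ : EuclideanSpace ℝ (Fin d)) :
    ‖measureFourier μ ξ‖ = ‖charFun μ ξ‖ := by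
  have h : measureFourier μ ξ = charFun μ (-ξ) := by
    rw [measureFourier, charFun_apply]
    refine integral_congr_ae (Eventually.of_forall fun x => ?_)
    simp only [inner_neg_right]
    congr 1
    push_cast
    ring
  rw [h, charFun_neg, RCLike.norm_conj]

theorem partialFourierIntegral_eq (T : ℝ) : partialFourierIntegral μ T =
    ∫ ξ in {ξ : EuclideanSpace ℝ (Fin d) | ‖ξ‖ ≤ T}, ‖charFun μ ξ‖ ^ 2 := by
  simp only [partialFourierIntegral, norm_measureFourier]

theorem partialFourierIntegral_nonneg (T : ℝ) : 0 ≤ partialFourierIntegral μ T :=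
  integral_nonneg fun ξ => by positivity

theorem measurableSet_norm_le (T : ℝ) :
    MeasurableSet {ξ : EuclideanSpace ℝ (Fin d) | ‖ξ‖ ≤ T} :=
  measurableSet_le (by fun_prop) (by fun_prop)

variable [IsProbabilityMeasure μ]

theorem integrableOn_normSq_charFun (T : ℝ) :
    IntegrableOn (fun ξ => ‖charFun μ ξ‖ ^ 2) {ξ : EuclideanSpace ℝ (Fin d) | ‖ξ‖ ≤ T} := by
  have hm := (measurable_charFun (μ := μ)).norm
  refine IntegrableOn.of_bound ?_ (Measurable.aestronglyMeasurable (by fun_prop)) 1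
    (Eventually.of_forall fun ξ => ?_)
  · have : {ξ : EuclideanSpace ℝ (Fin d) | ‖ξ‖ ≤ T} = Metric.closedBall 0 T := by
      ext; simp
    rw [this]
    exact measure_closedBall_lt_top
  · rw [Real.norm_of_nonneg (by positivity)]
    exact pow_le_one₀ (norm_nonneg _) (norm_charFun_le_one ξ)

theorem partialFourierIntegral_mono {S T : ℝ} (h : S ≤ T) :
    partialFourierIntegral μ S ≤ partialFourierIntegral μ T := by
  rw [partialFourierIntegral_eq, partialFourierIntegral_eq]
  exact setIntegral_mono_set (integrableOn_normSq_charFun μ T)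
    (Eventually.of_forall fun ξ => by positivity)
    (LE.le.eventuallyLE fun ξ (hξ : ‖ξ‖ ≤ S) => le_trans hξ h)

theorem lintegral_normSq_charFun (T : ℝ) :
    ∫⁻ ξ in {ξ : EuclideanSpace ℝ (Fin d) | ‖ξ‖ ≤ T}, ENNReal.ofReal (‖charFun μ ξ‖ ^ 2) =
      ENNReal.ofReal (partialFourierIntegral μ T) := by
  rw [partialFourierIntegral_eq, ofReal_integral_eq_lintegral_ofReal
    (integrableOn_normSq_charFun μ T) (Eventually.of_forall fun ξ => by positivity)]

/-- Dyadic estimate of the tail of a weighted `L²`-norm of the Fourier transform. -/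
theorem lintegral_tail_le {c T₀ a : ℝ} (hT₀ : 1 ≤ T₀) (ha : 0 < a) (hca : c < a)
    (hgrowth : ∀ T₁ T₂ : ℝ, T₀ ≤ T₁ → T₀ ≤ T₂ →
      partialFourierIntegral μ (T₁ * T₂) ≤ T₁ ^ c * partialFourierIntegral μ T₂)
    {Q R : ℝ} (hQ : T₀ ≤ Q) (hR : T₀ ≤ R) :
    ∫⁻ ξ in {ξ : EuclideanSpace ℝ (Fin d) | Q * R < ‖ξ‖},
        ENNReal.ofReal (‖charFun μ ξ‖ ^ 2 * ‖ξ‖ ^ (-a)) ≤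
      ENNReal.ofReal ((Q * R) ^ (-a) * (2 * Q) ^ c * partialFourierIntegral μ R *
        (1 - 2 ^ (c - a))⁻¹) := by
  have hQ0 : 0 < Q := by linarith
  have hR0 : 0 < R := by linarith
  have hF := partialFourierIntegral_nonneg μ R
  set X := Q * R with hX
  have hX0 : 0 < X := by positivity
  set r : ℝ := 2 ^ (c - a) with hr
  have hr0 : 0 < r := by positivity
  have hr1 : r < 1 := Real.rpow_lt_one_of_one_lt_of_neg (by norm_num) (by linarith)
  set A : ℕ → Set (EuclideanSpace ℝ (Fin d)) :=
    fun k => {ξ | 2 ^ k * X ≤ ‖ξ‖} ∩ {ξ | ‖ξ‖ ≤ 2 ^ (k + 1) * X} with hA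
  have hcover : {ξ : EuclideanSpace ℝ (Fin d) | X < ‖ξ‖} ⊆ ⋃ k, A k := by
    intro ξ hξ
    have hξ' : X < ‖ξ‖ := hξ
    obtain ⟨k, h1, h2⟩ := exists_nat_pow_near (x := ‖ξ‖ / X) (y := 2)
      ((one_le_div hX0).2 hξ'.le) one_lt_two
    exact Set.mem_iUnion.2 ⟨k, (le_div_iff₀ hX0).1 h1, ((div_lt_iff₀ hX0).1 h2).le⟩
  have hAk : ∀ k, ∫⁻ ξ in A k, ENNReal.ofReal (‖charFun μ ξ‖ ^ 2 * ‖ξ‖ ^ (-a)) ≤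
      ENNReal.ofReal (X ^ (-a) * (2 * Q) ^ c * partialFourierIntegral μ R * r ^ k) := by
    intro k
    have hAm : MeasurableSet (A k) :=
      (measurableSet_le (by fun_prop) (by fun_prop)).inter
        (measurableSet_le (by fun_prop) (by fun_prop))
    calc ∫⁻ ξ in A k, ENNReal.ofReal (‖charFun μ ξ‖ ^ 2 * ‖ξ‖ ^ (-a))
        ≤ ∫⁻ ξ in A k, ENNReal.ofReal ((2 ^ k * X) ^ (-a)) *
            ENNReal.ofReal (‖charFun μ ξ‖ ^ 2) := by
          refine setLIntegral_mono' hAm fun ξ hξ => ?_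
          rw [← ENNReal.ofReal_mul (by positivity)]
          refine ENNReal.ofReal_le_ofReal ?_
          rw [mul_comm]
          refine mul_le_mul_of_nonneg_right ?_ (by positivity)
          exact Real.rpow_le_rpow_of_nonpos (by positivity) hξ.1 (by linarith)
      _ = ENNReal.ofReal ((2 ^ k * X) ^ (-a)) *
            ∫⁻ ξ in A k, ENNReal.ofReal (‖charFun μ ξ‖ ^ 2) :=
          lintegral_const_mul' _ _ ENNReal.ofReal_ne_top
      _ ≤ ENNReal.ofReal ((2 ^ k * X) ^ (-a)) *
            ENNReal.ofReal (partialFourierIntegral μ (2 ^ (k + 1) * X)) := by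
          rw [← lintegral_normSq_charFun]
          gcongr
          exact fun ξ hξ => hξ.2
      _ ≤ ENNReal.ofReal ((2 ^ k * X) ^ (-a)) *
            ENNReal.ofReal ((2 ^ (k + 1) * Q) ^ c * partialFourierIntegral μ R) := by
          -- The growth hypothesis is used with `T₁ = 2^(k+1) Q` and `T₂ = R`. Against the weight
          -- `(2^k X)^(-a)` the shells then decay geometrically with ratio `r = 2^(c-a)`.
          have h1 : T₀ ≤ 2 ^ (k + 1) * Q :=
            hQ.trans (le_mul_of_one_le_left hQ0.le (one_le_pow₀ one_le_two))
          have h2 := hgrowth _ _ h1 hR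
          rw [mul_assoc, ← hX] at h2
          gcongr
      _ = ENNReal.ofReal (X ^ (-a) * (2 * Q) ^ c * partialFourierIntegral μ R * r ^ k) := by
          rw [← ENNReal.ofReal_mul (by positivity)]
          congr 1
          have e1 : ((2 : ℝ) ^ k * X) ^ (-a) = (2 ^ (-a)) ^ k * X ^ (-a) := by
            rw [Real.mul_rpow (by positivity) hX0.le, ← Real.rpow_natCast, ← Real.rpow_natCast,
              ← Real.rpow_mul (by norm_num), ← Real.rpow_mul (by norm_num), mul_comm (k : ℝ)]
          have e2 : ((2 : ℝ) ^ (k + 1) * Q) ^ c = (2 ^ c) ^ k * (2 * Q) ^ c := by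
            rw [pow_succ, mul_assoc, Real.mul_rpow (by positivity) (by positivity),
              ← Real.rpow_natCast, ← Real.rpow_natCast,
              ← Real.rpow_mul (by norm_num), ← Real.rpow_mul (by norm_num), mul_comm (k : ℝ)]
          have e3 : r = 2 ^ c * 2 ^ (-a) := by
            rw [hr, sub_eq_add_neg, Real.rpow_add (by norm_num)]
          rw [e1, e2, e3, mul_pow]
          ring
  calc _ ≤ ∫⁻ ξ in ⋃ k, A k, ENNReal.ofReal (‖charFun μ ξ‖ ^ 2 * ‖ξ‖ ^ (-a)) :=
        lintegral_mono_set hcover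
    _ ≤ ∑' k, ∫⁻ ξ in A k, ENNReal.ofReal (‖charFun μ ξ‖ ^ 2 * ‖ξ‖ ^ (-a)) :=
        lintegral_iUnion_le _ _
    _ ≤ ∑' k, ENNReal.ofReal (X ^ (-a) * (2 * Q) ^ c * partialFourierIntegral μ R * r ^ k) :=
        ENNReal.tsum_le_tsum hAk
    _ = _ := by
        rw [← ENNReal.ofReal_tsum_of_nonneg (fun k => by positivity)
          ((summable_geometric_of_lt_one hr0.le hr1).mul_left _), tsum_mul_left,
          tsum_geometric_of_lt_one hr0.le hr1]

end PartialFourier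

/-! ### Comparison of the Gaussian mixture with powers. -/

section GaussMixBounds

variable {d : ℕ}

theorem Real.exp_neg_le_rpow {p x : ℝ} (hp : 0 < p) (hx : 0 < x) :
    Real.exp (-x) ≤ p ^ p * x ^ (-p) := by
  have h1 : x / p ≤ Real.exp (x / p) := by linarith [Real.add_one_le_exp (x / p)]
  have h2 : (x / p) ^ p ≤ Real.exp x := by
    calc (x / p) ^ p ≤ Real.exp (x / p) ^ p := Real.rpow_le_rpow (by positivity) h1 hp.le
      _ = Real.exp x := by rw [← Real.exp_mul]; congr 1; field_simp
  rw [Real.div_rpow hx.le hp.le] at h2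
  rw [Real.exp_neg, Real.rpow_neg hx.le, ← div_eq_mul_inv]
  rw [inv_le_iff_one_le_mul₀ (Real.exp_pos x)]
  have h3 : 0 < x ^ p := by positivity
  have h4 : 0 < p ^ p := by positivity
  rw [div_mul_eq_mul_div, one_le_div h3]
  rw [div_le_iff₀ h4] at h2
  linarith

/-- Bounding each Gaussian by `c^c (4^(-n) ‖ξ‖²)^(-c)` leaves a geometric series of ratio `2^(2c -
a)`. The decay exponent `2c` is below the true one `a`, which is what makes the series converge. -/
theorem gaussMix_le (c : ℝ) (hc : 0 < c) {a : ℝ} (hca : 2 * c < a) :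
    ∃ C : ℝ, 0 ≤ C ∧ (∀ ξ : EuclideanSpace ℝ (Fin d), gaussMix (2 ^ (-a)) ξ ≤ ENNReal.ofReal C) ∧
      ∀ ξ : EuclideanSpace ℝ (Fin d), ξ ≠ 0 →
        gaussMix (2 ^ (-a)) ξ ≤ ENNReal.ofReal (C * ‖ξ‖ ^ (-(2 * c))) := by
  set q : ℝ := 2 ^ (-a) with hq
  have hq0 : 0 < q := by positivity
  have hq1 : q < 1 := Real.rpow_lt_one_of_one_lt_of_neg (by norm_num) (by linarith)
  set r : ℝ := 2 ^ (2 * c - a) with hr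
  have hr0 : 0 < r := by positivity
  have hr1 : r < 1 := Real.rpow_lt_one_of_one_lt_of_neg (by norm_num) (by linarith)
  have hqr : q * 4 ^ c = r := by
    have : (4 : ℝ) ^ c = 2 ^ (2 * c) := by
      rw [Real.rpow_mul (by norm_num)]; norm_num
    rw [this, hq, hr, ← Real.rpow_add (by norm_num)]
    congr 1; ring
  have hB : (1 - q)⁻¹ ≤ max (1 - q)⁻¹ (c ^ c * (1 - r)⁻¹) := le_max_left _ _
  have hpos : 0 < (1 - q)⁻¹ := inv_pos.2 (by linarith)
  refine ⟨max (1 - q)⁻¹ (c ^ c * (1 - r)⁻¹), hpos.le.trans hB, fun ξ => ?_, fun ξ hξ => ?_⟩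
  · calc gaussMix q ξ ≤ ∑' n : ℕ, ENNReal.ofReal (q ^ n) := by
          refine ENNReal.tsum_le_tsum fun n => mul_le_of_le_one_right' ?_
          rw [ENNReal.ofReal_le_one, Real.exp_le_one_iff]
          have : 0 ≤ (1 / 4 : ℝ) ^ n * ‖ξ‖ ^ 2 := by positivity
          linarith
      _ = ENNReal.ofReal (1 - q)⁻¹ := by
          rw [← ENNReal.ofReal_tsum_of_nonneg (fun n => by positivity)
            (summable_geometric_of_lt_one hq0.le hq1), tsum_geometric_of_lt_one hq0.le hq1]
      _ ≤ _ := ENNReal.ofReal_le_ofReal hB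
  · have hn : 0 < ‖ξ‖ := norm_pos_iff.2 hξ
    calc gaussMix q ξ ≤ ∑' n : ℕ, ENNReal.ofReal (c ^ c * ‖ξ‖ ^ (-(2 * c)) * r ^ n) := by
          refine ENNReal.tsum_le_tsum fun n => ?_
          rw [← ENNReal.ofReal_mul (by positivity)]
          refine ENNReal.ofReal_le_ofReal ?_
          have h1 := Real.exp_neg_le_rpow hc (x := (1 / 4) ^ n * ‖ξ‖ ^ 2) (by positivity)
          have h2 : ((1 / 4 : ℝ) ^ n * ‖ξ‖ ^ 2) ^ (-c) = (4 ^ c) ^ n * ‖ξ‖ ^ (-(2 * c)) := by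
            rw [Real.mul_rpow (by positivity) (by positivity)]
            congr 1
            · rw [one_div, inv_pow, Real.inv_rpow (by positivity), Real.rpow_neg (by positivity),
                inv_inv, ← Real.rpow_natCast, ← Real.rpow_natCast, ← Real.rpow_mul (by norm_num),
                ← Real.rpow_mul (by norm_num), mul_comm]
            · rw [← Real.rpow_natCast, ← Real.rpow_mul hn.le]
              congr 1; push_cast; ring
          rw [h2] at h1
          calc q ^ n * Real.exp (-(1 / 4) ^ n * ‖ξ‖ ^ 2)
              ≤ q ^ n * (c ^ c * ((4 ^ c) ^ n * ‖ξ‖ ^ (-(2 * c)))) := by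
                rw [neg_mul]; exact mul_le_mul_of_nonneg_left h1 (by positivity)
            _ = _ := by rw [← hqr, mul_pow]; ring
      _ = ENNReal.ofReal (c ^ c * (1 - r)⁻¹ * ‖ξ‖ ^ (-(2 * c))) := by
          rw [← ENNReal.ofReal_tsum_of_nonneg (fun n => by positivity)
            ((summable_geometric_of_lt_one hr0.le hr1).mul_left _), tsum_mul_left,
            tsum_geometric_of_lt_one hr0.le hr1]
          congr 1; ring
      _ ≤ _ := by
          refine ENNReal.ofReal_le_ofReal ?_
          exact mul_le_mul_of_nonneg_right (le_max_right _ _) (by positivity)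

theorem ofReal_le_gaussMix {q : ℝ} (hq : 0 ≤ q) (n : ℕ) (ξ : EuclideanSpace ℝ (Fin d)) :
    ENNReal.ofReal (q ^ n * Real.exp (-(1 / 4) ^ n * ‖ξ‖ ^ 2)) ≤ gaussMix q ξ := by
  rw [ENNReal.ofReal_mul (by positivity)]
  exact ENNReal.le_tsum n

/-- Functions bounded by `1` and by a multiple of `‖ξ‖ ^ (-a)` are dominated by `gaussMix`. -/
theorem le_gaussMix_of_decay {a B : ℝ} (ha : 0 < a) (hB : 0 ≤ B)
    {w : EuclideanSpace ℝ (Fin d) → ℝ} (h1 : ∀ ξ, w ξ ≤ 1)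
    (h2 : ∀ ξ, ξ ≠ 0 → w ξ ≤ B * ‖ξ‖ ^ (-a)) :
    ∀ ξ, ENNReal.ofReal (w ξ) ≤
      ENNReal.ofReal ((1 + B) * Real.exp 4) * gaussMix (2 ^ (-a)) ξ := by
  intro ξ
  have hq : (0 : ℝ) ≤ 2 ^ (-a) := by positivity
  obtain ⟨n, hn⟩ : ∃ n : ℕ, w ξ ≤
      (1 + B) * Real.exp 4 * ((2 ^ (-a)) ^ n * Real.exp (-(1 / 4) ^ n * ‖ξ‖ ^ 2)) := by
    rcases le_total ‖ξ‖ 1 with h | h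
    · refine ⟨0, (h1 ξ).trans ?_⟩
      have e1 : 1 ≤ Real.exp 4 * Real.exp (-1 * ‖ξ‖ ^ 2) := by
        rw [← Real.exp_add]
        refine Real.one_le_exp ?_
        have := pow_le_one₀ (norm_nonneg ξ) h (n := 2)
        linarith
      simp only [pow_zero, one_mul]
      rw [mul_assoc]
      exact one_le_mul_of_one_le_of_one_le (by linarith) e1
    -- A single term is enough: at the dyadic scale `2^n ≤ ‖ξ‖ < 2^(n+1)` the Gaussian exponent is
    -- at least `-4`, whence the factor `exp 4`.
    · obtain ⟨n, hn1, hn2⟩ := exists_nat_pow_near h one_lt_two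
      refine ⟨n, ?_⟩
      have hξ : 0 < ‖ξ‖ := by linarith
      have e1 : ‖ξ‖ ^ (-a) ≤ (2 ^ (-a)) ^ n := by
        rw [← Real.rpow_natCast, ← Real.rpow_mul (by norm_num), mul_comm, Real.rpow_mul (by norm_num),
          Real.rpow_natCast]
        exact Real.rpow_le_rpow_of_nonpos (by positivity) hn1 (by linarith)
      have e2 : 1 ≤ Real.exp 4 * Real.exp (-(1 / 4) ^ n * ‖ξ‖ ^ 2) := by
        rw [← Real.exp_add]
        refine Real.one_le_exp ?_
        have e3 : ‖ξ‖ ^ 2 ≤ (2 ^ (n + 1)) ^ 2 := pow_le_pow_left₀ hξ.le hn2.le 2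
        have e4 : (1 / 4 : ℝ) ^ n * (2 ^ (n + 1)) ^ 2 = 4 := by
          rw [← pow_mul, mul_comm (n + 1) 2, pow_mul, pow_succ, ← mul_assoc, ← mul_pow]; norm_num
        have e5 := mul_le_mul_of_nonneg_left e3 (show (0 : ℝ) ≤ (1 / 4) ^ n by positivity)
        linarith
      calc w ξ ≤ B * ‖ξ‖ ^ (-a) := h2 ξ (norm_pos_iff.1 hξ)
        _ ≤ (1 + B) * (2 ^ (-a)) ^ n := by gcongr; linarith
        _ ≤ (1 + B) * (2 ^ (-a)) ^ n * (Real.exp 4 * Real.exp (-(1 / 4) ^ n * ‖ξ‖ ^ 2)) :=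
            le_mul_of_one_le_right (by positivity) e2
        _ = _ := by ring
  calc ENNReal.ofReal (w ξ) ≤ ENNReal.ofReal ((1 + B) * Real.exp 4) *
        ENNReal.ofReal ((2 ^ (-a)) ^ n * Real.exp (-(1 / 4) ^ n * ‖ξ‖ ^ 2)) := by
        rw [← ENNReal.ofReal_mul (by positivity)]
        exact ENNReal.ofReal_le_ofReal hn
    _ ≤ _ := mul_le_mul_right (ofReal_le_gaussMix hq n ξ) _

/-- The weight is bounded on the ball and decays like `‖ξ‖^(-2c)` outside, which beats the growth
exponent `c`. The radius `T₀ * T₀` makes the tail estimate applicable with `Q = R = T₀`. -/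
theorem gaussMixEnergy_ne_top (μ : Measure (EuclideanSpace ℝ (Fin d))) [IsProbabilityMeasure μ]
    {c T₀ a : ℝ} (hT₀ : 1 ≤ T₀) (hc : 0 < c) (hca : 2 * c < a)
    (hgrowth : ∀ T₁ T₂ : ℝ, T₀ ≤ T₁ → T₀ ≤ T₂ →
      partialFourierIntegral μ (T₁ * T₂) ≤ T₁ ^ c * partialFourierIntegral μ T₂) :
    gaussMixEnergy (2 ^ (-a)) μ ≠ ⊤ := by
  obtain ⟨C, hC0, hC1, hC2⟩ := gaussMix_le (d := d) c hc hca
  set S : Set (EuclideanSpace ℝ (Fin d)) := {ξ | ‖ξ‖ ≤ T₀ * T₀}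
  have hS : MeasurableSet S := measurableSet_norm_le _
  have hSc : Sᶜ = {ξ : EuclideanSpace ℝ (Fin d) | T₀ * T₀ < ‖ξ‖} := by
    ext ξ; simp [S]
  rw [gaussMixEnergy, ← lintegral_add_compl _ hS]
  refine ENNReal.add_ne_top.2 ⟨ne_of_lt ?_, ne_of_lt ?_⟩
  · calc ∫⁻ ξ in S, ENNReal.ofReal (‖charFun μ ξ‖ ^ 2) * gaussMix (2 ^ (-a)) ξ
        ≤ ∫⁻ ξ in S, ENNReal.ofReal (‖charFun μ ξ‖ ^ 2) * ENNReal.ofReal C :=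
          lintegral_mono fun ξ => mul_le_mul_right (hC1 ξ) _
      _ = ENNReal.ofReal (partialFourierIntegral μ (T₀ * T₀)) * ENNReal.ofReal C := by
          rw [lintegral_mul_const' _ _ ENNReal.ofReal_ne_top, lintegral_normSq_charFun]
      _ < ⊤ := ENNReal.mul_lt_top ENNReal.ofReal_lt_top ENNReal.ofReal_lt_top
  · calc ∫⁻ ξ in Sᶜ, ENNReal.ofReal (‖charFun μ ξ‖ ^ 2) * gaussMix (2 ^ (-a)) ξ
        ≤ ∫⁻ ξ in Sᶜ, ENNReal.ofReal C *
            ENNReal.ofReal (‖charFun μ ξ‖ ^ 2 * ‖ξ‖ ^ (-(2 * c))) := by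
          refine setLIntegral_mono' hS.compl fun ξ hξ => ?_
          rw [hSc] at hξ
          have hξ0 : ξ ≠ 0 := by
            rintro rfl
            have h1 : T₀ * T₀ < ‖(0 : EuclideanSpace ℝ (Fin d))‖ := hξ
            rw [norm_zero] at h1
            nlinarith
          refine (mul_le_mul_right (hC2 ξ hξ0) _).trans (le_of_eq ?_)
          rw [← ENNReal.ofReal_mul (by positivity), ← ENNReal.ofReal_mul hC0]
          congr 1; ring
      _ = ENNReal.ofReal C *
            ∫⁻ ξ in Sᶜ, ENNReal.ofReal (‖charFun μ ξ‖ ^ 2 * ‖ξ‖ ^ (-(2 * c))) :=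
          lintegral_const_mul' _ _ ENNReal.ofReal_ne_top
      _ < ⊤ := by
          refine ENNReal.mul_lt_top ENNReal.ofReal_lt_top ?_
          rw [hSc]
          exact (lintegral_tail_le μ hT₀ (by linarith) (by linarith) hgrowth le_rfl le_rfl).trans_lt
            ENNReal.ofReal_lt_top

end GaussMixBounds

/-! ### Ball, annulus and tail. -/

section Main

variable {d : ℕ} {σ μ : Measure (EuclideanSpace ℝ (Fin d))}

/-- At the cutoff `X = δ⁻² R` one has `(δ / R) X = δ⁻¹`, so the decay of `σ̂` gains `δ^a`, while the
growth of `𝔽_μ` from `R` to `δ⁻² R` costs `δ^(-2c)`. -/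
theorem integral_tail_ge [IsProbabilityMeasure μ] {c T₀ a C : ℝ} (hT₀ : 1 ≤ T₀) (ha : 0 < a)
    (hca : c < a) (hC : 0 ≤ C)
    (hdecay : ∀ ξ, ξ ≠ 0 → |cosTransform σ ξ| ≤ C * ‖ξ‖ ^ (-a))
    (hgrowth : ∀ T₁ T₂ : ℝ, T₀ ≤ T₁ → T₀ ≤ T₂ →
      partialFourierIntegral μ (T₁ * T₂) ≤ T₁ ^ c * partialFourierIntegral μ T₂)
    {δ R : ℝ} (hδ : 0 < δ) (hδT : T₀ ≤ (δ ^ 2)⁻¹) (hR : T₀ ≤ R) :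
    -(C * 2 ^ c * (1 - 2 ^ (c - a))⁻¹ * δ ^ (a - 2 * c) * partialFourierIntegral μ R) ≤
      ∫ ξ in {ξ | (δ ^ 2)⁻¹ * R < ‖ξ‖}, ‖charFun μ ξ‖ ^ 2 * cosTransform σ ((δ / R) • ξ) := by
  have hR0 : 0 < R := by linarith
  set t := δ / R with ht
  have ht0 : 0 < t := by positivity
  set X := (δ ^ 2)⁻¹ * R with hX
  have hX0 : 0 < X := by positivity
  have hr1 : (2 : ℝ) ^ (c - a) < 1 :=
    Real.rpow_lt_one_of_one_lt_of_neg (by norm_num) (by linarith)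
  have hr2 : 0 < (1 - (2 : ℝ) ^ (c - a))⁻¹ := inv_pos.2 (by linarith)
  have hF := partialFourierIntegral_nonneg μ R
  have hSm : MeasurableSet {ξ : EuclideanSpace ℝ (Fin d) | X < ‖ξ‖} :=
    measurableSet_lt (by fun_prop) (by fun_prop)
  set Z := C * 2 ^ c * (1 - 2 ^ (c - a))⁻¹ * δ ^ (a - 2 * c) * partialFourierIntegral μ R with hZ
  have hZ0 : 0 ≤ Z := by positivity
  have hle : ∫⁻ ξ in {ξ | X < ‖ξ‖},
      ENNReal.ofReal ‖‖charFun μ ξ‖ ^ 2 * cosTransform σ (t • ξ)‖ ≤ ENNReal.ofReal Z := by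
    calc _ ≤ ∫⁻ ξ in {ξ : EuclideanSpace ℝ (Fin d) | X < ‖ξ‖}, ENNReal.ofReal (C * t ^ (-a)) *
            ENNReal.ofReal (‖charFun μ ξ‖ ^ 2 * ‖ξ‖ ^ (-a)) := by
          refine setLIntegral_mono' hSm fun ξ hξ => ?_
          have hξ' : X < ‖ξ‖ := hξ
          have hξ0 : ξ ≠ 0 := norm_pos_iff.1 (hX0.trans hξ')
          rw [← ENNReal.ofReal_mul (by positivity)]
          refine ENNReal.ofReal_le_ofReal ?_
          have h1 := hdecay (t • ξ) (smul_ne_zero ht0.ne' hξ0)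
          rw [norm_smul, Real.norm_of_nonneg ht0.le, Real.mul_rpow ht0.le (norm_nonneg _)] at h1
          rw [norm_mul, Real.norm_of_nonneg (sq_nonneg ‖charFun μ ξ‖), Real.norm_eq_abs]
          calc _ ≤ ‖charFun μ ξ‖ ^ 2 * (C * (t ^ (-a) * ‖ξ‖ ^ (-a))) :=
                mul_le_mul_of_nonneg_left h1 (sq_nonneg _)
            _ = _ := by ring
      _ = ENNReal.ofReal (C * t ^ (-a)) * ∫⁻ ξ in {ξ : EuclideanSpace ℝ (Fin d) | X < ‖ξ‖},
            ENNReal.ofReal (‖charFun μ ξ‖ ^ 2 * ‖ξ‖ ^ (-a)) :=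
          lintegral_const_mul' _ _ ENNReal.ofReal_ne_top
      _ ≤ ENNReal.ofReal (C * t ^ (-a)) * ENNReal.ofReal (X ^ (-a) * (2 * (δ ^ 2)⁻¹) ^ c *
            partialFourierIntegral μ R * (1 - 2 ^ (c - a))⁻¹) := by
          gcongr
          exact lintegral_tail_le μ hT₀ ha hca hgrowth hδT hR
      _ = ENNReal.ofReal Z := by
          rw [← ENNReal.ofReal_mul (by positivity)]
          congr 1
          have e1 : t ^ (-a) * X ^ (-a) = δ ^ a := by
            rw [← Real.mul_rpow ht0.le hX0.le]
            have : t * X = δ⁻¹ := by rw [ht, hX]; field_simp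
            rw [this, Real.rpow_neg (by positivity), Real.inv_rpow hδ.le, inv_inv]
          have e2 : (2 * (δ ^ 2)⁻¹) ^ c = 2 ^ c * δ ^ (-(2 * c)) := by
            rw [Real.mul_rpow (by norm_num) (by positivity), Real.inv_rpow (by positivity),
              ← Real.rpow_natCast, ← Real.rpow_mul hδ.le, Real.rpow_neg hδ.le]
            norm_num
          have e3 : δ ^ (a - 2 * c) = δ ^ a * δ ^ (-(2 * c)) := by
            rw [sub_eq_add_neg, Real.rpow_add hδ]
          rw [hZ, e2, e3, ← e1]
          ring
  have h1 := norm_integral_le_lintegral_norm (μ := volume.restrict {ξ | X < ‖ξ‖})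
    (fun ξ => ‖charFun μ ξ‖ ^ 2 * cosTransform σ (t • ξ))
  have h2 := h1.trans (ENNReal.toReal_le_of_le_ofReal hZ0 hle)
  rw [Real.norm_eq_abs] at h2
  exact neg_le_of_abs_le h2

/-- The transform is minorised by `1 - δ² / 2` on `‖ξ‖ ≤ R` and by `-κ` on the rest; the `+κ` in the
first coefficient compensates for subtracting `κ` over the whole larger ball. -/
theorem integral_ball_ge [IsProbabilityMeasure μ] (hσ : IsRadialSphereMeasure σ) {κ : ℝ}
    (hκ : ∀ ξ, -κ ≤ cosTransform σ ξ) {δ R X : ℝ} (hδ : 0 < δ) (hR : 0 < R) (hRX : R ≤ X)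
    (hint : Integrable fun ξ => ‖charFun μ ξ‖ ^ 2 * cosTransform σ ((δ / R) • ξ)) :
    (1 - δ ^ 2 / 2 + κ) * partialFourierIntegral μ R - κ * partialFourierIntegral μ X ≤
      ∫ ξ in {ξ | ‖ξ‖ ≤ X}, ‖charFun μ ξ‖ ^ 2 * cosTransform σ ((δ / R) • ξ) := by
  set S : Set (EuclideanSpace ℝ (Fin d)) := {ξ | ‖ξ‖ ≤ R} with hS
  set S' : Set (EuclideanSpace ℝ (Fin d)) := {ξ | ‖ξ‖ ≤ X} with hS'
  have hSm : MeasurableSet S := measurableSet_norm_le R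
  have hSm' : MeasurableSet S' := measurableSet_norm_le X
  have hsub : S' ∩ S = S :=
    Set.inter_eq_right.2 fun ξ (hξ : ‖ξ‖ ≤ R) => show ‖ξ‖ ≤ X from hξ.trans hRX
  have hi := integrableOn_normSq_charFun μ X
  have hi1 : IntegrableOn (S.indicator fun ξ => (1 - δ ^ 2 / 2 + κ) * ‖charFun μ ξ‖ ^ 2) S' :=
    IntegrableOn.integrable (hi.const_mul _) |>.indicator hSm
  have hi2 : IntegrableOn (fun ξ => κ * ‖charFun μ ξ‖ ^ 2) S' := hi.const_mul κ
  have hval : ∫ ξ in S', (S.indicator (fun ξ => (1 - δ ^ 2 / 2 + κ) * ‖charFun μ ξ‖ ^ 2) ξ -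
      κ * ‖charFun μ ξ‖ ^ 2) =
      (1 - δ ^ 2 / 2 + κ) * partialFourierIntegral μ R - κ * partialFourierIntegral μ X := by
    rw [integral_sub hi1 hi2, setIntegral_indicator hSm, hsub, integral_const_mul,
      integral_const_mul, partialFourierIntegral_eq, partialFourierIntegral_eq]
  rw [← hval]
  refine setIntegral_mono_on (hi1.sub hi2) hint.integrableOn hSm' fun ξ _ => ?_
  have hf : 0 ≤ ‖charFun μ ξ‖ ^ 2 := by positivity
  by_cases hξ : ξ ∈ S
  · rw [Set.indicator_of_mem hξ]
    have h1 := hσ.one_sub_le_cosTransform ((δ / R) • ξ)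
    have h2 : ‖(δ / R) • ξ‖ ≤ δ := by
      rw [norm_smul, Real.norm_of_nonneg (by positivity)]
      have h3 : ‖ξ‖ ≤ R := hξ
      calc δ / R * ‖ξ‖ ≤ δ / R * R := by gcongr
        _ = δ := by field_simp
    have h4 : ‖(δ / R) • ξ‖ ^ 2 ≤ δ ^ 2 := pow_le_pow_left₀ (norm_nonneg _) h2 2
    have h5 : 1 - δ ^ 2 / 2 ≤ cosTransform σ ((δ / R) • ξ) := by linarith
    have h6 := mul_le_mul_of_nonneg_left h5 hf
    linarith
  · rw [Set.indicator_of_notMem hξ]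
    have h6 := mul_le_mul_of_nonneg_left (hκ ((δ / R) • ξ)) hf
    linarith

/-- If `δ / R` is not a distance in `E`, then the Fourier transform of `μ` has substantial mass in
the annulus `R < ‖ξ‖ ≤ δ⁻² R`. -/
theorem mass_annulus_of_notMem_distanceSet [IsProbabilityMeasure μ]
    (hσ : IsRadialSphereMeasure σ) {c T₀ a C κ : ℝ} (hT₀ : 1 ≤ T₀) (hc : 0 < c)
    (hca : 2 * c < a) (hC : 0 ≤ C)
    (hdecay : ∀ ξ, ξ ≠ 0 → |cosTransform σ ξ| ≤ C * ‖ξ‖ ^ (-a))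
    (hκ : ∀ ξ, -κ ≤ cosTransform σ ξ)
    {E : Set (EuclideanSpace ℝ (Fin d))} (hμ : μ Eᶜ = 0)
    (hgrowth : ∀ T₁ T₂ : ℝ, T₀ ≤ T₁ → T₀ ≤ T₂ →
      partialFourierIntegral μ (T₁ * T₂) ≤ T₁ ^ c * partialFourierIntegral μ T₂)
    {δ R : ℝ} (hδ : 0 < δ) (hδT : T₀ ≤ (δ ^ 2)⁻¹) (hR : T₀ ≤ R) (hE : δ / R ∉ distanceSet E) :
    (1 - (δ ^ 2 / 2 + C * 2 ^ c * (1 - 2 ^ (c - a))⁻¹ * δ ^ (a - 2 * c))) *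
        partialFourierIntegral μ R ≤
      κ * (partialFourierIntegral μ ((δ ^ 2)⁻¹ * R) - partialFourierIntegral μ R) := by
  have := hσ.isProb
  have hR0 : 0 < R := by linarith
  have ht0 : 0 < δ / R := by positivity
  have hRX : R ≤ (δ ^ 2)⁻¹ * R := le_mul_of_one_le_left hR0.le (hT₀.trans hδT)
  have henergy := gaussMixEnergy_ne_top μ hT₀ hc hca hgrowth
  have hdom := le_gaussMix_of_decay (a := a) (B := C * (δ / R) ^ (-a)) (by linarith) (by positivity)
    (w := fun ξ => |cosTransform σ ((δ / R) • ξ)|) (fun ξ => abs_cosTransform_le_one _)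
    (fun ξ hξ => by
      have h1 := hdecay ((δ / R) • ξ) (smul_ne_zero ht0.ne' hξ)
      rwa [norm_smul, Real.norm_of_nonneg ht0.le, Real.mul_rpow ht0.le (norm_nonneg _),
        ← mul_assoc] at h1)
  have hint := integrable_of_gaussMixEnergy (σ := σ) henergy hdom
  have hzero := integral_eq_zero_of_notMem_distanceSet hσ hμ ht0 hE henergy hdom
  -- The whole integral is zero, so the lower bounds for ball and tail sum to at most zero;
  -- rearranged, this is the claim.
  rw [← integral_add_compl (measurableSet_norm_le ((δ ^ 2)⁻¹ * R)) hint] at hzero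
  have hcompl : {ξ : EuclideanSpace ℝ (Fin d) | ‖ξ‖ ≤ (δ ^ 2)⁻¹ * R}ᶜ =
      {ξ | (δ ^ 2)⁻¹ * R < ‖ξ‖} := by
    ext ξ; simp
  rw [hcompl] at hzero
  have h1 := integral_ball_ge hσ hκ hδ hR0 hRX hint
  have h2 := integral_tail_ge (σ := σ) (μ := μ) hT₀ (by linarith) (by linarith) hC hdecay hgrowth hδ
    hδT hR
  linarith

/-- Telescoping: separation gives `F (k * R j) ≤ F (R (j + 1))`, so each outer value is absorbed by
the next inner one. -/
theorem sum_annuli_le {F : ℝ → ℝ} (hmono : Monotone F) (hF : ∀ T, 0 ≤ F T) {k : ℝ} {R : ℕ → ℝ}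
    {J : ℕ} (hJ : 1 ≤ J) (hR : ∀ j, 1 ≤ j → j < J → k * R j ≤ R (j + 1)) :
    ∑ j ∈ Finset.Icc 1 J, (F (k * R j) - F (R j)) ≤ F (k * R J) := by
  induction J, hJ using Nat.le_induction with
  | base => simpa using hF (R 1)
  | succ n hn ih =>
    rw [Finset.sum_Icc_succ_top (by omega)]
    have h1 := ih fun j h1 h2 => hR j h1 (by omega)
    have h2 := hmono (hR n hn (by omega))
    linarith

end Main

theorem theorem1p5 (d : ℕ) (hd : 2 ≤ d) (c : ℝ) (hc₀ : 0 < c) (hc : c < ((d : ℝ) - 1) / 4)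
    (T₀ : ℝ) (hT₀ : 1 ≤ T₀) (M : ℝ) (hM : 4 ≤ M) :
    ∃ δM : ℝ, 0 < δM ∧
      ∀ (E : Set (EuclideanSpace ℝ (Fin d))), E ⊆ unitCube d →
      ∀ (μ : Measure (EuclideanSpace ℝ (Fin d))), IsProbabilityMeasure μ → μ Eᶜ = 0 →
        (∀ T₁ T₂ : ℝ, T₀ ≤ T₁ → T₀ ≤ T₂ →
          partialFourierIntegral μ (T₁ * T₂) ≤ T₁ ^ c * partialFourierIntegral μ T₂) →
      ∀ (δ : ℝ), 0 < δ → δ < δM →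
      ∀ (J : ℕ), 1 ≤ J → ∀ (R : ℕ → ℝ),
        (∀ j : ℕ, 1 ≤ j → j ≤ J → T₀ < R j) →
        (∀ j : ℕ, 1 ≤ j → j < J → (δ ^ 2)⁻¹ * R j ≤ R (j + 1)) →
        (1 - 2 / M) * partialFourierIntegral μ ((δ ^ 2)⁻¹ * R J)
          < ∑ j ∈ Finset.Icc 1 J, partialFourierIntegral μ (R j) →
        ∃ j : ℕ, 1 ≤ j ∧ j ≤ J ∧ δ / R j ∈ distanceSet E := by
  obtain ⟨σ, hσ⟩ := exists_isRadialSphereMeasure hd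
  obtain ⟨C, hC1, hdecay⟩ := hσ.exists_abs_cosTransform_le hd
  obtain ⟨κ, hκ0, hκ1, hκ⟩ := hσ.exists_lower_bound hd
  set a : ℝ := ((d : ℝ) - 1) / 2 with ha
  have hca : 2 * c < a := by rw [ha]; linarith
  set D : ℝ := C * 2 ^ c * (1 - 2 ^ (c - a))⁻¹ with hD
  have hlim : Tendsto (fun δ : ℝ => δ ^ 2 / 2 + D * δ ^ (a - 2 * c)) (𝓝[>] 0) (𝓝 0) := by
    have h1 : ContinuousAt (fun δ : ℝ => δ ^ 2 / 2 + D * δ ^ (a - 2 * c)) 0 :=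
      ContinuousAt.add (by fun_prop)
        ((Real.continuousAt_rpow_const 0 _ (Or.inr (by linarith))).const_mul D)
    have h2 := h1.tendsto.mono_left (nhdsWithin_le_nhds (s := Set.Ioi 0))
    simpa [Real.zero_rpow (show a - 2 * c ≠ 0 by linarith)] using h2
  have hlim2 : Tendsto (fun δ : ℝ => (δ ^ 2)⁻¹) (𝓝[>] 0) atTop := by
    refine tendsto_inv_nhdsGT_zero.comp (tendsto_nhdsWithin_iff.2 ⟨?_, ?_⟩)
    · have h1 : Tendsto (fun δ : ℝ => δ ^ 2) (𝓝 0) (𝓝 (0 ^ 2)) := (continuous_pow 2).tendsto 0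
      simpa using h1.mono_left nhdsWithin_le_nhds
    · exact eventually_mem_nhdsWithin.mono fun δ (h : 0 < δ) => pow_pos h 2
  -- An error below `1 - 2κ`, positive since `κ < 1/2`, leaves a factor `1 - error > 2κ`, hence the
  -- ratio `2` in each annulus. The condition `T₀ ≤ δ⁻²` makes the growth hypothesis available in
  -- the tail.
  obtain ⟨δM, hδM, hsub⟩ := mem_nhdsGT_iff_exists_Ioo_subset.1
    ((hlim.eventually (gt_mem_nhds (show (0 : ℝ) < 1 - 2 * κ by linarith))).and
      (hlim2.eventually (eventually_ge_atTop T₀)))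
  refine ⟨δM, hδM, fun E _ μ hμp hμ hgrowth δ hδ hδM' J hJ R hRT hRR hsum => ?_⟩
  obtain ⟨hsmall, hδT⟩ := hsub ⟨hδ, hδM'⟩
  by_contra! hcon
  have hF := partialFourierIntegral_nonneg μ
  have hj : ∀ j ∈ Finset.Icc 1 J, 2 * partialFourierIntegral μ (R j) ≤
      partialFourierIntegral μ ((δ ^ 2)⁻¹ * R j) - partialFourierIntegral μ (R j) := by
    intro j hj
    obtain ⟨h1, h2⟩ := Finset.mem_Icc.1 hj
    have h3 := mass_annulus_of_notMem_distanceSet hσ hT₀ hc₀ hca (by linarith) hdecay hκ hμ hgrowth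
      hδ hδT (hRT j h1 h2).le (hcon j h1 h2)
    have h4 : 2 * κ * partialFourierIntegral μ (R j) ≤
        (1 - (δ ^ 2 / 2 + D * δ ^ (a - 2 * c))) * partialFourierIntegral μ (R j) :=
      mul_le_mul_of_nonneg_right (by linarith) (hF _)
    refine le_of_mul_le_mul_left ?_ hκ0
    linarith
  have h5 := Finset.sum_le_sum hj
  rw [← Finset.mul_sum] at h5
  have h6 := sum_annuli_le (fun _ _ h => partialFourierIntegral_mono μ h) hF hJ hRR
  -- The only role of `M`: the threshold `1 - 2/M` is at least `1/2`, and `δM` itself was chosen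
  -- independently of `M`.
  have h7 : 2 / M ≤ 1 / 2 := by
    rw [div_le_div_iff₀ (by linarith) (by norm_num)]; linarith
  have h8 : 1 / 2 * partialFourierIntegral μ ((δ ^ 2)⁻¹ * R J) ≤
      (1 - 2 / M) * partialFourierIntegral μ ((δ ^ 2)⁻¹ * R J) :=
    mul_le_mul_of_nonneg_right (by linarith) (hF _)
  linarith
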